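/- For an integer $r\ge 2$, an $r$-graph $G$ is a finite vertex set $V(G)$ together with a set $E(G)$ of $r$-element subsets of $V(G)$, called edges; write $v(G)=|V(G)|$. Let $\delta_{r-1}(G)$ be the minimum, over all $(r-1)$-element subsets $S$ of $V(G)$, of the number of edges of $G$ containing $S$ (and $0$ if $V(G)$ has no such subset). For $q>r$, a copy of $K_q^r$ in $G$ is a $q$-element subset of $V(G)$ all of whose $r$-element subsets are edges of $G$, and a fractional $K_q^r$-decomposition of $G$ is an assignment of non-negative real weights to the copies of $K_q^r$ in $G$ such that, for every $e\in E(G)$, the weights of the copies containing $e$ sum to exactly $1$. The fractional $K_q^r$-decomposition threshold $\delta^*_{K_q^r}$ is the infimum of all real numbers $c$ such that every $r$-graph $G$ with $\delta_{r-1}(G)\ge c\cdot v(G)$ admits a fractional $K_q^r$-decomposition. Theorem. For every integer $r\ge 3$ and every real $\varepsilon\in(0,1]$ there exists a constant $C>0$ such that for every integer $q>r$ $$\delta^*_{K_q^r}\le 1-\frac{C}{q^{\,r-1+\varepsilon}},$$ and, moreover, with the same $C$, every $r$-graph $G$ with $\delta_{r-1}(G)\ge\left(1-\frac{C}{q^{\,r-1+\varepsilon}}\right)v(G)$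 admits a fractional $K_q^r$-decomposition. -/

import Mathlib

/-- An `r`-uniform hypergraph on the vertex set `V`. -/
structure RGraph (V : Type*) (r : ℕ) where
  /-- The edge set. -/
  edges : Finset (Finset V)
  /-- Every edge has exactly `r` vertices. -/
  card_edge : ∀ e ∈ edges, e.card = r

namespace RGraph

variable {V : Type*} [Fintype V] [DecidableEq V] {r : ℕ}

/-- The degree of a set `S` of vertices: the number of edges that contain `S`. -/
def degree (G : RGraph V r) (S : Finset V) : ℕ :=
  (G.edges.filter (fun e => S ⊆ e)).card

/-- The minimum `(r - 1)`-degree: the minimum of `G.degree S` over all `(r - 1)`-sets `S` of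
vertices. If there is no such set (and hence no edge), the value is `0`. -/
noncomputable def minCodegree (G : RGraph V r) : ℕ :=
  ⨅ S : {S : Finset V // S.card + 1 = r}, G.degree S.1

/-- The copies of the complete `r`-graph on `q` vertices in `G`, given by their vertex sets:
the `q`-sets of vertices all of whose `r`-subsets are edges. -/
def cliques (G : RGraph V r) (q : ℕ) : Finset (Finset V) :=
  Finset.univ.filter (fun Q => Q.card = q ∧ ∀ e ∈ Q.powersetCard r, e ∈ G.edges)

/-- `w` is a fractional `K_q^r`-decomposition of `G`: the weights of the copies of `K_q^r` are
non-negative, and on each edge the weights of the copies containing it sum to exactly `1`.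
(Values of `w` on sets other than vertex sets of copies play no role.) -/
def IsFractionalDecomposition (G : RGraph V r) (q : ℕ) (w : Finset V → ℝ) : Prop :=
  (∀ Q ∈ G.cliques q, 0 ≤ w Q) ∧
    ∀ e ∈ G.edges, ∑ Q ∈ (G.cliques q).filter (fun Q => e ⊆ Q), w Q = 1

/-- `G` admits a fractional `K_q^r`-decomposition. -/
def HasFractionalDecomposition (G : RGraph V r) (q : ℕ) : Prop :=
  ∃ w : Finset V → ℝ, G.IsFractionalDecomposition q w

end RGraph

/-- The real numbers `c` such that every (finite) `r`-graph `G` with minimum `(r - 1)`-degree at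
least `c * v(G)` admits a fractional `K_q^r`-decomposition. -/
def fractionalDecompositionConstants (q r : ℕ) : Set ℝ :=
  {c : ℝ | ∀ (V : Type) [Fintype V] [DecidableEq V] (G : RGraph V r),
    c * (Fintype.card V : ℝ) ≤ (G.minCodegree : ℝ) → G.HasFractionalDecomposition q}

/-- The fractional `K_q^r`-decomposition threshold. For `2 ≤ r < q` the infimum is over a nonempty
set bounded below, see the two lemmas after this definition. -/
noncomputable def fractionalDecompositionThreshold (q r : ℕ) : ℝ :=
  sInf (fractionalDecompositionConstants q r)

theorem fractionalDecompositionConstants_nonempty {q r : ℕ} (hr : 2 ≤ r) :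
    (fractionalDecompositionConstants q r).Nonempty := by
  refine ⟨1, ?_⟩
  intro V _ _ G hG
  suffices h : G.edges = ∅ by
    exact ⟨fun _ => 0, fun _ _ => le_rfl, by simp [h]⟩
  rw [one_mul, Nat.cast_le] at hG
  by_contra hne
  obtain ⟨e, he⟩ := Finset.nonempty_iff_ne_empty.mpr hne
  have hec := G.card_edge e he
  obtain ⟨S, hSe, hSc⟩ := Finset.exists_subset_card_eq (s := e) (n := r - 1) (by omega)
  have h1 : G.minCodegree ≤ G.degree S :=
    ciInf_le (OrderBot.bddBelow _) (⟨S, by omega⟩ : {S : Finset V // S.card + 1 = r})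
  -- an edge containing `S` is `S` together with one vertex outside `S`
  have h2 : G.degree S ≤ (Sᶜ).card := by
    have hsub : G.edges.filter (fun e => S ⊆ e) ⊆ (Sᶜ).image (fun v => insert v S) := by
      intro f hf
      rw [Finset.mem_filter] at hf
      have hfc := G.card_edge f hf.1
      have hd : (f \ S).card = 1 := by
        rw [Finset.card_sdiff_of_subset hf.2]; omega
      obtain ⟨v, hv⟩ := Finset.card_eq_one.mp hd
      have hvm : v ∈ f \ S := by rw [hv]; exact Finset.mem_singleton_self v
      rw [Finset.mem_image]
      refine ⟨v, Finset.mem_compl.mpr (Finset.mem_sdiff.mp hvm).2, ?_⟩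
      rw [← Finset.singleton_union, ← hv, Finset.sdiff_union_of_subset hf.2]
    exact (Finset.card_le_card hsub).trans Finset.card_image_le
  rw [Finset.card_compl] at h2
  have h3 := Finset.card_le_univ S
  omega

theorem fractionalDecompositionConstants_bddBelow {q r : ℕ} (hq : r < q) :
    BddBelow (fractionalDecompositionConstants q r) := by
  refine ⟨0, fun c hc => ?_⟩
  by_contra hneg
  rw [not_le] at hneg
  -- a single edge contains no copy of `K_q^r`
  let G : RGraph (Fin r) r := ⟨{Finset.univ}, by simp⟩
  obtain ⟨w, -, hw⟩ := hc (Fin r) G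
    ((mul_nonpos_of_nonpos_of_nonneg hneg.le (Nat.cast_nonneg _)).trans (Nat.cast_nonneg _))
  have h1 := hw Finset.univ (by simp [G])
  have h0 : G.cliques q = ∅ := by
    refine Finset.filter_eq_empty_iff.mpr fun Q _ hQ => ?_
    have := Finset.card_le_univ Q
    rw [Fintype.card_fin, hQ.1] at this
    omega
  rw [h0] at h1
  simp at h1

/-!
The proof gives the bound already with exponent `r - 1` in place of `r - 1 + ε`.

Let `n = |V|`, let `c` be the allowed fraction of non-extensions of an `(r - 1)`-set, and put
`m = M * q` with a constant `M` depending on `r` only. Fix the activity `ρ = 1 / (4 * n)`. One looks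
for a measure on the cliques of `G` for which the cliques containing a given clique `X` have total
weight `(m)_{|X|} ρ^{|X|}`, a quantity that depends on `|X|` only; in particular all edges are
covered equally. Inclusion–exclusion leaves only one candidate (`shearerWeight`): up to a positive
factor, the weight of `Q` is the alternating sum `shearerSum` over the cliques extending `Q`, that
is, an independence polynomial at negative activity, as in Shearer's theorem on the Lovász local
lemma. The point is that these sums are positive as long as `c * m ^ (r - 1)` is small.

Positivity follows from the stronger statement `IsSparse.ratioBound`, that enlarging `Q` by a vertex
`v` changes the sum by a factor of at most `2`. It is proved by induction on the number of slots,
for all subfamilies of the family of missing `r`-sets at once. The missing sets through `v` are put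
back one at a time; by induction, restoring `F` costs a relative amount of at most
`(m / n) ^ |F \ (Q ∪ {v})|` (`RatioBound.abs_sub_insert_le`). The sum of these costs is at most of
order `c * m ^ (r - 1)`, because the last new vertex of `F` is one of at most `c * n` non-extensions
of an `(r - 1)`-set (`RGraph.isSparse_missing`).

The ratio bounds also show that a slot is filled with probability bounded below, so cliques with
fewer than `2 * q` vertices carry an exponentially small part of the weight
(`IsSparse.sum_shearerWeight_small_le`). Discarding them leaves a covering of the edges by large
cliques with errors exponentially small in `q`. Such errors are corrected inside each large clique:
a complete `r`-graph on at least `2 * q` vertices whose edge weights differ from `1` by a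
sufficiently small inverse polynomial is a non-negative combination of copies of `K_q^r`
(`exists_weighting_of_near_one`), since `edgeGadget` isolates a single edge.
-/

open Finset

/-! ### Alternating sums over extensions of a set -/

section ShearerSum

variable {V : Type*}

/-- `X` is independent for the family `𝓕` of forbidden sets: it contains no member of `𝓕`. -/
def IsIndep (𝓕 : Finset (Finset V)) (X : Finset V) : Prop := ∀ F ∈ 𝓕, ¬ F ⊆ X

instance [DecidableEq V] (𝓕 : Finset (Finset V)) (X : Finset V) : Decidable (IsIndep 𝓕 X) := by
  unfold IsIndep; infer_instance

theorem IsIndep.mono {𝓕 𝓖 : Finset (Finset V)} {X Y : Finset V} (h : IsIndep 𝓕 Y)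
    (h𝓖 : 𝓖 ⊆ 𝓕) (hXY : X ⊆ Y) : IsIndep 𝓖 X :=
  fun F hF hFX => h F (h𝓖 hF) (hFX.trans hXY)

theorem isIndep_insert [DecidableEq V] {𝓕 : Finset (Finset V)} {F X : Finset V} :
    IsIndep (insert F 𝓕) X ↔ ¬ F ⊆ X ∧ IsIndep 𝓕 X := by
  simp [IsIndep]

variable [Fintype V] [DecidableEq V]

/-- The alternating sum `∑ (j)_{|R|} (-ρ)^{|R|}` over the sets `R` that extend `Q` to an independent
set. The falling factorial counts the ways of placing `R` injectively into `j` labelled slots, so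
this is the independence polynomial at negative activity `-ρ` of the link of `Q`, when at most `j`
further vertices may be added. It vanishes if `Q` is not independent. -/
noncomputable def shearerSum (𝓕 : Finset (Finset V)) (ρ : ℝ) (Q : Finset V) (j : ℕ) : ℝ :=
  ∑ R with Disjoint Q R ∧ IsIndep 𝓕 (Q ∪ R), (j.descFactorial #R : ℝ) * (-ρ) ^ #R

theorem shearerSum_of_not_isIndep {𝓕 : Finset (Finset V)} {ρ : ℝ} {Q : Finset V} {j : ℕ}
    (h : ¬ IsIndep 𝓕 Q) : shearerSum 𝓕 ρ Q j = 0 := by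
  refine sum_eq_zero fun R hR => absurd ?_ h
  exact ((mem_filter.1 hR).2.2).mono subset_rfl subset_union_left

theorem shearerSum_zero {𝓕 : Finset (Finset V)} {ρ : ℝ} {Q : Finset V}
    (h : IsIndep 𝓕 Q) : shearerSum 𝓕 ρ Q 0 = 1 := by
  unfold shearerSum
  rw [sum_eq_single_of_mem ∅ (by simpa using h)]
  · simp
  · intro R _ hR
    have : 0 < #R := card_pos.2 (nonempty_iff_ne_empty.2 hR)
    rw [Nat.descFactorial_of_lt this]; simp

/-- The extensions of `Q` that contain `S` correspond to the extensions of `Q ∪ S`. -/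
theorem sum_extensions_superset (𝓕 : Finset (Finset V)) {Q S : Finset V} (hQS : Disjoint Q S)
    (h : ℕ → ℝ) :
    ∑ R with (Disjoint Q R ∧ IsIndep 𝓕 (Q ∪ R)) ∧ S ⊆ R, h #R =
      ∑ R with Disjoint (Q ∪ S) R ∧ IsIndep 𝓕 (Q ∪ S ∪ R), h (#R + #S) := by
  refine sum_bij' (fun R _ => R \ S) (fun R _ => R ∪ S) ?_ ?_ ?_ ?_ ?_
  · intro R hR
    simp only [mem_filter, mem_univ, true_and] at hR ⊢
    obtain ⟨⟨h1, h2⟩, h3⟩ := hR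
    refine ⟨disjoint_union_left.2 ⟨h1.mono_right sdiff_subset, disjoint_sdiff⟩, ?_⟩
    rwa [union_assoc, union_sdiff_of_subset h3]
  · intro R hR
    simp only [mem_filter, mem_univ, true_and] at hR ⊢
    obtain ⟨h1, h2⟩ := hR
    refine ⟨⟨disjoint_union_right.2 ⟨(disjoint_union_left.1 h1).1, hQS⟩, ?_⟩, subset_union_right⟩
    rwa [union_comm R S, ← union_assoc]
  · intro R hR
    simp only [mem_filter, mem_univ, true_and] at hR
    exact sdiff_union_of_subset hR.2
  · intro R hR
    simp only [mem_filter, mem_univ, true_and] at hR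
    exact union_sdiff_cancel_right (disjoint_union_left.1 hR.1).2.symm
  · intro R hR
    simp only [mem_filter, mem_univ, true_and] at hR
    rw [card_sdiff_of_subset hR.2, Nat.sub_add_cancel (card_le_card hR.2)]

theorem descFactorial_add' (j h k : ℕ) :
    j.descFactorial (k + h) = j.descFactorial h * (j - h).descFactorial k := by
  have := Nat.descFactorial_mul_descFactorial (n := j) (k := h) (m := k + h) (by omega)
  rw [Nat.add_sub_cancel] at this
  rw [← this, mul_comm]

theorem sum_extensions_superset_eq (𝓕 : Finset (Finset V)) {Q S : Finset V} (hQS : Disjoint Q S)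
    (ρ : ℝ) (j : ℕ) :
    ∑ R with (Disjoint Q R ∧ IsIndep 𝓕 (Q ∪ R)) ∧ S ⊆ R,
        (j.descFactorial #R : ℝ) * (-ρ) ^ #R =
      (j.descFactorial #S : ℝ) * (-ρ) ^ #S * shearerSum 𝓕 ρ (Q ∪ S) (j - #S) := by
  rw [sum_extensions_superset 𝓕 hQS (fun k => (j.descFactorial k : ℝ) * (-ρ) ^ k), shearerSum,
    mul_sum]
  refine sum_congr rfl fun R _ => ?_
  rw [descFactorial_add', pow_add]; push_cast; ring

/-- Forbidding one more set `F` removes the extensions that contain `F`. -/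
theorem shearerSum_sub_insert (𝓕 : Finset (Finset V)) (ρ : ℝ) (Q F : Finset V) (j : ℕ) :
    shearerSum 𝓕 ρ Q j - shearerSum (insert F 𝓕) ρ Q j =
      (j.descFactorial #(F \ Q) : ℝ) * (-ρ) ^ #(F \ Q) *
        shearerSum 𝓕 ρ (Q ∪ F) (j - #(F \ Q)) := by
  have h1 := sum_extensions_superset_eq 𝓕 (Q := Q) (S := F \ Q) disjoint_sdiff ρ j
  rw [union_sdiff_self_eq_union] at h1
  rw [← h1, sub_eq_iff_eq_add, shearerSum, shearerSum,
    ← sum_filter_add_sum_filter_not (univ.filter fun R => Disjoint Q R ∧ IsIndep 𝓕 (Q ∪ R))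
      (fun R => F \ Q ⊆ R), filter_filter, filter_filter]
  congr 1
  refine sum_congr (filter_congr fun R _ => ?_) fun _ _ => rfl
  have h : F \ Q ⊆ R ↔ F ⊆ Q ∪ R := sdiff_le_iff
  rw [isIndep_insert, h]; tauto

/-- The sum splits according to whether the extension contains `v`. -/
theorem shearerSum_eq_sub (𝓕 : Finset (Finset V)) (ρ : ℝ) {Q : Finset V} {v : V} (hv : v ∉ Q)
    (j : ℕ) :
    shearerSum 𝓕 ρ Q j = shearerSum (𝓕.filter (v ∉ ·)) ρ (insert v Q) j -
      ρ * j * shearerSum 𝓕 ρ (insert v Q) (j - 1) := by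
  have h1 := sum_extensions_superset_eq 𝓕 (Q := Q) (S := {v}) (by simpa using hv) ρ j
  have h2 : Q ∪ {v} = insert v Q := by rw [union_comm]; rfl
  rw [h2, card_singleton, pow_one, Nat.descFactorial_one] at h1
  have h3 : ρ * j * shearerSum 𝓕 ρ (insert v Q) (j - 1) =
    - (j * -ρ * shearerSum 𝓕 ρ (insert v Q) (j - 1)) := by ring
  rw [h3, ← h1, sub_neg_eq_add, shearerSum, shearerSum, add_comm,
    ← sum_filter_add_sum_filter_not (univ.filter fun R => Disjoint Q R ∧ IsIndep 𝓕 (Q ∪ R))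
      (fun R => {v} ⊆ R), filter_filter, filter_filter]
  congr 1
  refine sum_congr (filter_congr fun R _ => ?_) fun _ _ => rfl
  rw [singleton_subset_iff, disjoint_insert_left]
  have key : v ∉ R → (IsIndep (𝓕.filter (v ∉ ·)) (insert v Q ∪ R) ↔ IsIndep 𝓕 (Q ∪ R)) := by
    intro hR
    have hvm : v ∉ Q ∪ R := by simp [hv, hR]
    rw [insert_union]
    constructor
    · intro h F hF hFs
      exact h F (mem_filter.2 ⟨hF, fun h' => hvm (hFs h')⟩) (hFs.trans (subset_insert _ _))
    · intro h F hF hFs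
      rw [mem_filter] at hF
      exact h F hF.1 ((subset_insert_iff_of_notMem hF.2).1 hFs)
  tauto

/-- Opening one more slot: it stays empty or receives a vertex `v`. -/
theorem shearerSum_succ (𝓕 : Finset (Finset V)) (ρ : ℝ) (Q : Finset V) (j : ℕ) :
    shearerSum 𝓕 ρ Q (j + 1) =
      shearerSum 𝓕 ρ Q j - ρ * ∑ v ∈ Qᶜ, shearerSum 𝓕 ρ (insert v Q) j := by
  have h1 : ∀ v ∈ Qᶜ, -ρ * shearerSum 𝓕 ρ (insert v Q) j =
      ∑ R with Disjoint Q R ∧ IsIndep 𝓕 (Q ∪ R), if v ∈ R then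
        (j.descFactorial (#R - 1) : ℝ) * (-ρ) ^ #R else 0 := by
    intro v hv
    rw [mem_compl] at hv
    have h := sum_extensions_superset 𝓕 (Q := Q) (S := {v}) (by simpa using hv)
      (fun k => (j.descFactorial (k - 1) : ℝ) * (-ρ) ^ k)
    have h2 : Q ∪ {v} = insert v Q := by rw [union_comm]; rfl
    simp only [h2, singleton_subset_iff, card_singleton, Nat.add_sub_cancel] at h
    rw [← sum_filter, filter_filter, h, shearerSum, mul_sum]
    exact sum_congr rfl fun R _ => by ring
  have h2 : -ρ * ∑ v ∈ Qᶜ, shearerSum 𝓕 ρ (insert v Q) j =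
      ∑ R with Disjoint Q R ∧ IsIndep 𝓕 (Q ∪ R),
        (#R : ℝ) * ((j.descFactorial (#R - 1) : ℝ) * (-ρ) ^ #R) := by
    rw [mul_sum, sum_congr rfl h1, sum_comm]
    refine sum_congr rfl fun R hR => ?_
    rw [← sum_filter, sum_const, nsmul_eq_mul]
    congr 3
    ext v
    simp only [mem_filter, mem_univ, true_and] at hR
    simp only [mem_filter, mem_compl, and_iff_right_iff_imp]
    exact fun hv hvQ => disjoint_left.1 hR.1 hvQ hv
  rw [sub_eq_add_neg, ← neg_mul, h2, shearerSum, shearerSum, ← sum_add_distrib]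
  refine sum_congr rfl fun R _ => ?_
  have h3 : (j + 1).descFactorial #R =
      j.descFactorial #R + #R * j.descFactorial (#R - 1) := by
    rcases Nat.eq_zero_or_pos #R with h | h
    · simp [h]
    · obtain ⟨k, hk⟩ := Nat.exists_eq_succ_of_ne_zero h.ne'
      rw [hk, Nat.succ_descFactorial_succ, Nat.descFactorial_succ, Nat.succ_sub_one]
      rcases le_or_gt k j with h' | h'
      · obtain ⟨d, rfl⟩ := Nat.exists_eq_add_of_le h'
        rw [Nat.add_sub_cancel_left, Nat.succ_eq_add_one]; ring
      · rw [Nat.descFactorial_of_lt h']; simp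
  rw [h3]; push_cast; ring

end ShearerSum

/-! ### Sparse families and bounds for ratios of alternating sums -/

section RatioBounds

variable {V : Type*} [Fintype V]

/-- The family `𝓕` is sparse at scale `m`: around every vertex `v`, and after fixing any further set
`Q` of fewer than `m` vertices, the members of `𝓕` through `v` that are not yet complete have small
total weight, where each vertex still missing costs a factor `m / |V|`. -/
structure IsSparse [DecidableEq V] (𝓕 : Finset (Finset V)) (m : ℕ) : Prop where
  le_card : 8 * (m : ℝ) ≤ Fintype.card V
  sum_le : ∀ (Q : Finset V) (v : V), #Q + 1 ≤ m →
    ∑ F ∈ 𝓕 with v ∈ F ∧ ¬ F ⊆ insert v Q,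
      ((m : ℝ) / Fintype.card V) ^ #(F \ insert v Q) ≤ 1 / 8

variable (V) in
/-- The activity at which the alternating sums are evaluated. -/
noncomputable def activity : ℝ := (4 * (Fintype.card V : ℝ))⁻¹

theorem activity_nonneg : 0 ≤ activity V := by unfold activity; positivity

theorem card_mul_activity_le : Fintype.card V * activity V ≤ 1 / 4 := by
  unfold activity
  rcases eq_or_ne (Fintype.card V : ℝ) 0 with h | h
  · rw [h]; norm_num
  · apply le_of_eq; field_simp

variable [DecidableEq V]

/-- For all subfamilies of `𝓕`, including a further vertex in `Q` changes the alternating sum with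
`j` slots by a factor of at most `2`. -/
def RatioBound (𝓕 : Finset (Finset V)) (m j : ℕ) : Prop :=
  ∀ 𝓖 ⊆ 𝓕, ∀ (Q : Finset V) (v : V), v ∉ Q → IsIndep 𝓖 (insert v Q) → #Q + 1 + j ≤ m →
    shearerSum 𝓖 (activity V) Q j ≤ 2 * shearerSum 𝓖 (activity V) (insert v Q) j ∧
    shearerSum 𝓖 (activity V) (insert v Q) j ≤ 2 * shearerSum 𝓖 (activity V) Q j

variable {𝓕 𝓖 : Finset (Finset V)} {m : ℕ}

/-- An additional slot removes at most half of the sum: each of the `|V|` vertices that may fill it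
contributes at most `2 * activity V = 1 / (2 * |V|)` times the sum. -/
theorem RatioBound.le_two_mul_succ {j : ℕ} (hR : RatioBound 𝓕 m j) (h𝓖 : 𝓖 ⊆ 𝓕) {Q : Finset V}
    (hQ : #Q + 1 + j ≤ m) (h0 : 0 ≤ shearerSum 𝓖 (activity V) Q j) :
    shearerSum 𝓖 (activity V) Q j ≤ 2 * shearerSum 𝓖 (activity V) Q (j + 1) := by
  rw [shearerSum_succ]
  have h1 : ∑ v ∈ Qᶜ, shearerSum 𝓖 (activity V) (insert v Q) j ≤
      Fintype.card V * (2 * shearerSum 𝓖 (activity V) Q j) := by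
    calc _ ≤ ∑ v ∈ Qᶜ, 2 * shearerSum 𝓖 (activity V) Q j := by
          refine sum_le_sum fun v hv => ?_
          by_cases hi : IsIndep 𝓖 (insert v Q)
          · exact (hR 𝓖 h𝓖 Q v (mem_compl.1 hv) hi hQ).2
          · rw [shearerSum_of_not_isIndep hi]; positivity
      _ ≤ _ := by
          rw [sum_const, nsmul_eq_mul]
          have : (#Qᶜ : ℝ) ≤ Fintype.card V := by exact_mod_cast card_le_univ _
          gcongr
  have h2 := mul_le_mul_of_nonneg_left h1 (activity_nonneg (V := V))
  have h3 := mul_le_mul_of_nonneg_right (card_mul_activity_le (V := V))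
    (mul_nonneg zero_le_two h0)
  nlinarith

theorem RatioBound.pos {j : ℕ} (hR : ∀ i < j, RatioBound 𝓕 m i) (h𝓖 : 𝓖 ⊆ 𝓕) {Q : Finset V}
    (hi : IsIndep 𝓖 Q) (hQ : #Q + j ≤ m) : 0 < shearerSum 𝓖 (activity V) Q j := by
  induction j with
  | zero => rw [shearerSum_zero hi]; exact one_pos
  | succ j ih =>
    have h := ih (fun i hij => hR i (by omega)) (by omega)
    have := (hR j (by omega)).le_two_mul_succ h𝓖 (Q := Q) (by omega) h.le
    linarith

theorem RatioBound.union_le {j : ℕ} (hR : RatioBound 𝓕 m j) (h𝓖 : 𝓖 ⊆ 𝓕) {Q : Finset V}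
    (A : Finset V) (hA : Disjoint Q A) (hi : IsIndep 𝓖 (Q ∪ A)) (hQ : #Q + #A + j ≤ m) :
    shearerSum 𝓖 (activity V) (Q ∪ A) j ≤ 2 ^ #A * shearerSum 𝓖 (activity V) Q j := by
  induction A using Finset.induction_on with
  | empty => simp
  | insert a A ha ih =>
    rw [card_insert_of_notMem ha] at hQ ⊢
    rw [disjoint_insert_right] at hA
    rw [union_insert] at hi ⊢
    have h1 := ih hA.2 (hi.mono subset_rfl (subset_insert _ _)) (by omega)
    have h2 := (hR 𝓖 h𝓖 (Q ∪ A) a (by simp [hA.1, ha]) hi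
      (by rw [card_union_of_disjoint hA.2]; omega)).2
    rw [pow_succ]; linarith

theorem RatioBound.slots_le {j : ℕ} (hR : ∀ i < j, RatioBound 𝓕 m i) (h𝓖 : 𝓖 ⊆ 𝓕) {Q : Finset V}
    (hi : IsIndep 𝓖 Q) (hQ : #Q + j ≤ m) {h : ℕ} (hh : h ≤ j) :
    shearerSum 𝓖 (activity V) Q (j - h) ≤ 2 ^ h * shearerSum 𝓖 (activity V) Q j := by
  induction h with
  | zero => simp
  | succ h ih =>
    have h1 := ih (by omega)
    have h2 := (hR (j - (h + 1)) (by omega)).le_two_mul_succ h𝓖 (Q := Q) (by omega)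
      (RatioBound.pos (fun i hij => hR i (by omega)) h𝓖 hi (by omega)).le
    rw [show j - (h + 1) + 1 = j - h by omega] at h2
    rw [pow_succ]; linarith

/-- Forbidding one more set `F` changes the alternating sum by a relative amount of at most
`(m / |V|) ^ |F \ Q|`. -/
theorem RatioBound.abs_sub_insert_le {j : ℕ} (hR : ∀ i < j, RatioBound 𝓕 m i) (h𝓖 : 𝓖 ⊆ 𝓕)
    {Q F : Finset V} (hi : IsIndep 𝓖 Q) (hF : ¬ F ⊆ Q) (hQ : #Q + j ≤ m) :
    |shearerSum 𝓖 (activity V) Q j - shearerSum (insert F 𝓖) (activity V) Q j| ≤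
      ((m : ℝ) / Fintype.card V) ^ #(F \ Q) * shearerSum 𝓖 (activity V) Q j := by
  have hpos := RatioBound.pos hR h𝓖 hi hQ
  have hrhs : 0 ≤ ((m : ℝ) / Fintype.card V) ^ #(F \ Q) * shearerSum 𝓖 (activity V) Q j := by
    positivity
  rw [shearerSum_sub_insert]
  by_cases hiF : IsIndep 𝓖 (Q ∪ F)
  swap
  · rw [shearerSum_of_not_isIndep hiF]; simpa using hrhs
  have h1 : 0 < #(F \ Q) := card_pos.2 (sdiff_nonempty.2 hF)
  set h := #(F \ Q) with hh
  rcases lt_or_ge j h with hjh | hjh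
  · rw [Nat.descFactorial_of_lt hjh]; simpa using hrhs
  have hun := (hR (j - h) (by omega)).union_le h𝓖 (Q := Q) (F \ Q) disjoint_sdiff
    (by rwa [union_sdiff_self_eq_union]) (by omega)
  rw [union_sdiff_self_eq_union, ← hh] at hun
  have hsl := RatioBound.slots_le hR h𝓖 hi hQ hjh
  have hposF : 0 < shearerSum 𝓖 (activity V) (Q ∪ F) (j - h) := by
    refine RatioBound.pos (fun i hij => hR i (by omega)) h𝓖 hiF ?_
    rw [← union_sdiff_self_eq_union, card_union_of_disjoint disjoint_sdiff]; omega
  have hdf : (j.descFactorial h : ℝ) ≤ (m : ℝ) ^ h := by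
    calc (j.descFactorial h : ℝ) ≤ (j : ℝ) ^ h := by exact_mod_cast Nat.descFactorial_le_pow j h
      _ ≤ _ := by gcongr; omega
  have ha := activity_nonneg (V := V)
  rw [abs_mul, abs_mul, abs_pow, abs_neg, abs_of_nonneg ha, abs_of_pos hposF, Nat.abs_cast]
  calc (j.descFactorial h : ℝ) * activity V ^ h * shearerSum 𝓖 (activity V) (Q ∪ F) (j - h)
      ≤ (m : ℝ) ^ h * activity V ^ h * (2 ^ h * (2 ^ h * shearerSum 𝓖 (activity V) Q j)) := by
        gcongr
        exact hun.trans (by gcongr)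
    _ = ((m : ℝ) * activity V * 2 * 2) ^ h * shearerSum 𝓖 (activity V) Q j := by
        rw [mul_pow, mul_pow, mul_pow]; ring
    _ = _ := by
        congr 2; unfold activity; rw [mul_inv, div_eq_mul_inv]; ring

/-- The effect of adding all members of `T` to the family, obtained by adding them one at a time. -/
theorem RatioBound.union_family {j : ℕ} (hR : ∀ i < j, RatioBound 𝓕 m i) (h𝓖 : 𝓖 ⊆ 𝓕)
    {Q : Finset V} (hQ : #Q + j ≤ m) (T : Finset (Finset V)) (hT : T ⊆ 𝓕)
    (hi : IsIndep (T ∪ 𝓖) Q) (hs : ∑ F ∈ T, ((m : ℝ) / Fintype.card V) ^ #(F \ Q) ≤ 1 / 8) :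
    (1 - ∑ F ∈ T, ((m : ℝ) / Fintype.card V) ^ #(F \ Q)) * shearerSum 𝓖 (activity V) Q j ≤
        shearerSum (T ∪ 𝓖) (activity V) Q j ∧
      shearerSum (T ∪ 𝓖) (activity V) Q j ≤
        (1 + 2 * ∑ F ∈ T, ((m : ℝ) / Fintype.card V) ^ #(F \ Q)) *
          shearerSum 𝓖 (activity V) Q j := by
  induction T using Finset.induction_on with
  | empty => simp
  | insert F T hFT ih =>
    rw [sum_insert hFT] at hs ⊢
    rw [insert_subset_iff] at hT
    rw [insert_union] at hi ⊢
    rw [isIndep_insert] at hi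
    have hx : 0 ≤ ((m : ℝ) / Fintype.card V) ^ #(F \ Q) := by positivity
    have hS : 0 ≤ ∑ F ∈ T, ((m : ℝ) / Fintype.card V) ^ #(F \ Q) :=
      sum_nonneg fun _ _ => by positivity
    obtain ⟨h1, h2⟩ := ih hT.2 hi.2 (by linarith)
    have h3 := abs_le.1 (RatioBound.abs_sub_insert_le hR (union_subset hT.2 h𝓖) hi.2 hi.1 hQ)
    have h0 := RatioBound.pos hR h𝓖 (hi.2.mono subset_union_right subset_rfl) hQ
    set x := ((m : ℝ) / Fintype.card V) ^ #(F \ Q)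
    set S := ∑ F ∈ T, ((m : ℝ) / Fintype.card V) ^ #(F \ Q)
    set z := shearerSum 𝓖 (activity V) Q j
    set y := shearerSum (T ∪ 𝓖) (activity V) Q j
    constructor
    -- the products of the factors `1 - x` and `1 + x` are bounded by linear functions of the sum
    · have h4 : (1 - x) * ((1 - S) * z) ≤ (1 - x) * y := by
        apply mul_le_mul_of_nonneg_left h1; linarith
      have h5 : 0 ≤ x * S * z := by positivity
      nlinarith
    · have h4 : (1 + x) * y ≤ (1 + x) * ((1 + 2 * S) * z) := by
        apply mul_le_mul_of_nonneg_left h2; linarith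
      have h5 : x * (2 * S) * z ≤ x * 1 * z := by
        gcongr; linarith
      nlinarith

/-- The alternating sums for `Q` and `insert v Q` are compared through the subfamily of the sets that
avoid `v`: for it the two sums agree up to the extensions through `v`, and the sets through `v` are
then put back. -/
theorem IsSparse.ratioBound (h𝓕 : IsSparse 𝓕 m) (j : ℕ) : RatioBound 𝓕 m j := by
  induction j using Nat.strong_induction_on with
  | _ j hR =>
  intro 𝓖 h𝓖 Q v hv hi hQ
  have hQ' : #(insert v Q) + j ≤ m := by rw [card_insert_of_notMem hv]; omega
  have hsum : ∑ F ∈ 𝓖 with v ∈ F, ((m : ℝ) / Fintype.card V) ^ #(F \ insert v Q) ≤ 1 / 8 := by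
    refine le_trans (sum_le_sum_of_subset_of_nonneg ?_ fun _ _ _ => by positivity)
      (h𝓕.sum_le Q v (by omega))
    intro F hF
    rw [mem_filter] at hF ⊢
    exact ⟨h𝓖 hF.1, hF.2, hi F hF.1⟩
  have hsplit : (𝓖.filter (v ∈ ·)) ∪ (𝓖.filter (v ∉ ·)) = 𝓖 := filter_union_filter_not_eq _ _
  have h1 := RatioBound.union_family hR ((filter_subset (v ∉ ·) 𝓖).trans h𝓖) hQ'
    (𝓖.filter (v ∈ ·)) ((filter_subset _ _).trans h𝓖) (by rwa [hsplit]) hsum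
  rw [hsplit] at h1
  have h2 := shearerSum_eq_sub 𝓖 (activity V) hv j
  have hB := RatioBound.pos hR h𝓖 hi hQ'
  have hA := RatioBound.pos hR ((filter_subset (v ∉ ·) 𝓖).trans h𝓖)
    (hi.mono (filter_subset _ _) subset_rfl) hQ'
  set A := shearerSum (𝓖.filter (v ∉ ·)) (activity V) (insert v Q) j
  set B := shearerSum 𝓖 (activity V) (insert v Q) j
  set S := ∑ F ∈ 𝓖 with v ∈ F, ((m : ℝ) / Fintype.card V) ^ #(F \ insert v Q)
  -- the extensions of `Q` through `v` are a small part of the total, since there are few slots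
  have h3 : 0 ≤ activity V * j * shearerSum 𝓖 (activity V) (insert v Q) (j - 1) ∧
      activity V * j * shearerSum 𝓖 (activity V) (insert v Q) (j - 1) ≤ B / 16 := by
    rcases Nat.eq_zero_or_pos j with hj | hj
    · subst hj; simp only [Nat.cast_zero, mul_zero, zero_mul, le_refl, true_and]; positivity
    · have hs := RatioBound.slots_le hR h𝓖 hi hQ' (h := 1) hj
      have hp := RatioBound.pos (fun i hij => hR i (by omega)) h𝓖 hi
        (show #(insert v Q) + (j - 1) ≤ m by omega)
      have ha := activity_nonneg (V := V)
      refine ⟨by positivity, ?_⟩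
      have hj' : (j : ℝ) ≤ m := by exact_mod_cast (by omega : j ≤ m)
      have hc := card_mul_activity_le (V := V)
      have haj : activity V * j ≤ 1 / 32 := by
        have := mul_le_mul_of_nonneg_left (hj'.trans (by linarith [h𝓕.le_card] :
          (m : ℝ) ≤ Fintype.card V / 8)) ha
        linarith
      calc _ ≤ 1 / 32 * (2 ^ 1 * B) := by gcongr
        _ = _ := by ring
  rw [h2]
  have h4 : (7 / 8) * A ≤ (1 - S) * A := by gcongr; linarith
  have h5 : (1 + 2 * S) * A ≤ (5 / 4) * A := by gcongr; linarith
  constructor <;> linarith [h1.1, h1.2, h3.1, h3.2]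

theorem IsSparse.shearerSum_nonneg (h𝓕 : IsSparse 𝓕 m) {Q : Finset V} {j : ℕ} (hQ : #Q + j ≤ m) :
    0 ≤ shearerSum 𝓕 (activity V) Q j := by
  by_cases hi : IsIndep 𝓕 Q
  · exact (RatioBound.pos (fun i _ => h𝓕.ratioBound i) subset_rfl hi hQ).le
  · rw [shearerSum_of_not_isIndep hi]

/-- If most vertices can be added to every independent set of fewer than `m` vertices, then
the alternating sums decay exponentially in the number of slots. -/
theorem IsSparse.shearerSum_le (h𝓕 : IsSparse 𝓕 m)
    (hext : ∀ Q : Finset V, IsIndep 𝓕 Q → #Q < m →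
      (Fintype.card V : ℝ) / 2 ≤ #{v ∈ Qᶜ | IsIndep 𝓕 (insert v Q)})
    {Q : Finset V} {j : ℕ} (hQ : #Q + j ≤ m) :
    shearerSum 𝓕 (activity V) Q j ≤ (15 / 16) ^ j := by
  by_cases hi : IsIndep 𝓕 Q
  swap
  · rw [shearerSum_of_not_isIndep hi]; positivity
  induction j with
  | zero => rw [shearerSum_zero hi, pow_zero]
  | succ j ih =>
    rw [shearerSum_succ]
    have h0 := h𝓕.shearerSum_nonneg (Q := Q) (j := j) (by omega)
    have h1 : (Fintype.card V : ℝ) / 2 * (shearerSum 𝓕 (activity V) Q j / 2) ≤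
        ∑ v ∈ Qᶜ, shearerSum 𝓕 (activity V) (insert v Q) j := by
      calc _ ≤ (#{v ∈ Qᶜ | IsIndep 𝓕 (insert v Q)} : ℝ) *
            (shearerSum 𝓕 (activity V) Q j / 2) := by
            gcongr
            exact hext Q hi (by omega)
        _ = ∑ v ∈ Qᶜ with IsIndep 𝓕 (insert v Q), shearerSum 𝓕 (activity V) Q j / 2 := by
            rw [sum_const, nsmul_eq_mul]
        _ ≤ ∑ v ∈ Qᶜ with IsIndep 𝓕 (insert v Q), shearerSum 𝓕 (activity V) (insert v Q) j := by
            refine sum_le_sum fun v hv => ?_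
            rw [mem_filter, mem_compl] at hv
            linarith [(h𝓕.ratioBound j 𝓕 subset_rfl Q v hv.1 hv.2 (by omega)).1]
        _ ≤ _ := by
            refine sum_le_sum_of_subset_of_nonneg (filter_subset _ _) fun v hv _ => ?_
            rw [mem_compl] at hv
            exact h𝓕.shearerSum_nonneg (by rw [card_insert_of_notMem hv]; omega)
    have hn : 0 < (Fintype.card V : ℝ) := by
      have : (1 : ℝ) ≤ m := by exact_mod_cast (by omega : 1 ≤ m)
      linarith [h𝓕.le_card]
    have h2 := mul_le_mul_of_nonneg_left h1 (activity_nonneg (V := V))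
    have h3 : activity V * ((Fintype.card V : ℝ) / 2 * (shearerSum 𝓕 (activity V) Q j / 2)) =
        shearerSum 𝓕 (activity V) Q j / 16 := by
      unfold activity; field_simp; ring
    have h4 := ih (by omega)
    rw [pow_succ]
    linarith

end RatioBounds

/-! ### Shearer's measure -/

section ShearerMeasure

variable {V : Type*} [Fintype V] [DecidableEq V] {𝓕 : Finset (Finset V)} {m : ℕ}

/-- The weight of `Q` in Shearer's measure with at most `m` vertices: the inclusion–exclusion
formula for the weight of exactly `Q`, when each independent set `X` is to be contained in the
random set with weight `(m)_{|X|} ρ^{|X|}`. -/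
noncomputable def shearerWeight (𝓕 : Finset (Finset V)) (m : ℕ) (Q : Finset V) : ℝ :=
  (m.descFactorial #Q : ℝ) * activity V ^ #Q * shearerSum 𝓕 (activity V) Q (m - #Q)

theorem shearerWeight_of_not_isIndep {Q : Finset V} (h : ¬ IsIndep 𝓕 Q) :
    shearerWeight 𝓕 m Q = 0 := by
  rw [shearerWeight, shearerSum_of_not_isIndep h, mul_zero]

theorem shearerWeight_of_lt {Q : Finset V} (h : m < #Q) : shearerWeight 𝓕 m Q = 0 := by
  rw [shearerWeight, Nat.descFactorial_of_lt h]; simp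

theorem IsSparse.shearerWeight_nonneg (h𝓕 : IsSparse 𝓕 m) (Q : Finset V) :
    0 ≤ shearerWeight 𝓕 m Q := by
  rcases lt_or_ge m #Q with h | h
  · rw [shearerWeight_of_lt h]
  · have := h𝓕.shearerSum_nonneg (Q := Q) (j := m - #Q) (by omega)
    have := activity_nonneg (V := V)
    unfold shearerWeight; positivity

/-- Shearer's measure is flat: the total weight of the sets containing an independent set `X`
depends only on the size of `X`. -/
theorem sum_shearerWeight (𝓕 : Finset (Finset V)) (m : ℕ) {X : Finset V} (hX : IsIndep 𝓕 X) :
    ∑ Q with X ⊆ Q, shearerWeight 𝓕 m Q = (m.descFactorial #X : ℝ) * activity V ^ #X := by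
  have h1 : ∀ Q : Finset V, shearerWeight 𝓕 m Q =
      ∑ R with Disjoint Q R ∧ IsIndep 𝓕 (Q ∪ R),
        (m.descFactorial #(Q ∪ R) : ℝ) * activity V ^ #(Q ∪ R) * (-1) ^ #R := by
    intro Q
    rw [shearerWeight, shearerSum, mul_sum]
    refine sum_congr rfl fun R hR => ?_
    rw [mem_filter] at hR
    rw [card_union_of_disjoint hR.2.1, add_comm #Q, descFactorial_add', pow_add, neg_pow]
    push_cast; ring
  simp_rw [h1]
  -- after collecting the pairs `(Q, R)` by `Y = Q ∪ R`, the signs cancel unless `Y = X`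
  have h2 : ∀ Y : Finset V, X ⊆ Y → ∑ R ∈ (Y \ X).powerset, (-1 : ℝ) ^ #R =
      if Y = X then 1 else 0 := by
    intro Y hY
    have h := sum_powerset_neg_one_pow_card (x := Y \ X)
    have h' : Y \ X = ∅ ↔ Y = X := by
      rw [sdiff_eq_empty_iff_subset]; exact ⟨fun h => h.antisymm hY, fun h => h.subset⟩
    simp only [h'] at h
    exact_mod_cast h
  calc _ = ∑ Y with X ⊆ Y ∧ IsIndep 𝓕 Y, ∑ R ∈ (Y \ X).powerset,
        (m.descFactorial #Y : ℝ) * activity V ^ #Y * (-1) ^ #R := by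
        rw [sum_sigma', sum_sigma']
        refine sum_bij' (fun p _ => ⟨p.1 ∪ p.2, p.2⟩) (fun p _ => ⟨p.1 \ p.2, p.2⟩)
          ?_ ?_ ?_ ?_ ?_
        · rintro ⟨Q, R⟩ h
          simp only [mem_sigma, mem_filter, mem_univ, true_and, mem_powerset] at h ⊢
          refine ⟨⟨h.1.trans subset_union_left, h.2.2⟩, ?_⟩
          exact subset_sdiff.2 ⟨subset_union_right, (h.2.1.mono_left h.1).symm⟩
        · rintro ⟨Y, R⟩ h
          simp only [mem_sigma, mem_filter, mem_univ, true_and, mem_powerset] at h ⊢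
          obtain ⟨⟨ha, hb⟩, hc⟩ := h
          rw [subset_sdiff] at hc
          exact ⟨subset_sdiff.2 ⟨ha, hc.2.symm⟩, sdiff_disjoint,
            by rwa [sdiff_union_of_subset hc.1]⟩
        · rintro ⟨Q, R⟩ h
          simp only [mem_sigma, mem_filter, mem_univ, true_and] at h
          simp only [union_sdiff_cancel_right h.2.1]
        · rintro ⟨Y, R⟩ h
          simp only [mem_sigma, mem_powerset] at h
          simp only [sdiff_union_of_subset (h.2.trans sdiff_subset)]
        · rintro ⟨Q, R⟩ _
          rfl
    _ = ∑ Y with X ⊆ Y ∧ IsIndep 𝓕 Y,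
        if Y = X then (m.descFactorial #Y : ℝ) * activity V ^ #Y else 0 := by
        refine sum_congr rfl fun Y hY => ?_
        rw [mem_filter] at hY
        rw [← mul_sum, h2 Y hY.2.1]; split_ifs <;> simp
    _ = _ := by
        rw [sum_ite_eq']
        simp [hX]

/-- Shearer's measure gives little weight to the sets with few vertices. -/
theorem IsSparse.sum_shearerWeight_small_le (h𝓕 : IsSparse 𝓕 m)
    (hext : ∀ Q : Finset V, IsIndep 𝓕 Q → #Q < m →
      (Fintype.card V : ℝ) / 2 ≤ #{v ∈ Qᶜ | IsIndep 𝓕 (insert v Q)})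
    (X : Finset V) {s : ℕ} (hs : s ≤ m) :
    ∑ Q with X ⊆ Q ∧ #Q < s, shearerWeight 𝓕 m Q ≤
      (m.descFactorial #X : ℝ) * activity V ^ #X *
        ((∑ l ∈ range s, (m : ℝ) ^ l / l.factorial) * (15 / 16) ^ (m - s)) := by
  have ha := activity_nonneg (V := V)
  have hmaps : ∀ Q ∈ (univ.filter fun Q : Finset V => X ⊆ Q ∧ #Q < s), #Q - #X ∈ range s := by
    intro Q hQ
    rw [mem_filter] at hQ
    rw [mem_range]; omega
  rw [← sum_fiberwise_of_maps_to hmaps, sum_mul, mul_sum]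
  refine sum_le_sum fun l _ => ?_
  have hterm : ∀ Q ∈ (univ.filter fun Q : Finset V => X ⊆ Q ∧ #Q < s).filter
      (fun Q => #Q - #X = l), shearerWeight 𝓕 m Q ≤
        (m.descFactorial #X : ℝ) * activity V ^ #X *
          (((m : ℝ) * activity V) ^ l * (15 / 16) ^ (m - s)) := by
    intro Q hQ
    simp only [mem_filter, mem_univ, true_and] at hQ
    obtain ⟨⟨hXQ, hQs⟩, hl⟩ := hQ
    have hcard : #Q = l + #X := by have := card_le_card hXQ; omega
    have h1 : shearerSum 𝓕 (activity V) Q (m - #Q) ≤ (15 / 16) ^ (m - s) :=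
      (h𝓕.shearerSum_le hext (by omega)).trans
        (pow_le_pow_of_le_one (by norm_num) (by norm_num) (by omega))
    have h2 : ((m - #X).descFactorial l : ℝ) ≤ (m : ℝ) ^ l := by
      calc ((m - #X).descFactorial l : ℝ) ≤ ((m - #X : ℕ) : ℝ) ^ l := by
            exact_mod_cast Nat.descFactorial_le_pow _ l
        _ ≤ _ := by gcongr; omega
    have h3 := h𝓕.shearerSum_nonneg (Q := Q) (j := m - #Q) (by omega)
    calc shearerWeight 𝓕 m Q = (m.descFactorial #X : ℝ) * activity V ^ #X *
          ((m - #X).descFactorial l * activity V ^ l *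
            shearerSum 𝓕 (activity V) Q (m - #Q)) := by
          rw [shearerWeight, hcard, descFactorial_add', pow_add]; push_cast; ring
      _ ≤ (m.descFactorial #X : ℝ) * activity V ^ #X *
          ((m : ℝ) ^ l * activity V ^ l * (15 / 16) ^ (m - s)) := by
          gcongr
      _ = _ := by rw [mul_pow]
  have hcount : (#((univ.filter fun Q : Finset V => X ⊆ Q ∧ #Q < s).filter
      (fun Q => #Q - #X = l)) : ℝ) ≤ (Fintype.card V : ℝ) ^ l / l.factorial := by
    refine le_trans ?_ (Nat.choose_le_pow_div l (Fintype.card V))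
    rw [← card_univ, ← card_powersetCard]
    refine Nat.cast_le.2 (card_le_card_of_injOn (fun Q => Q \ X) ?_ ?_)
    · intro Q hQ
      simp only [mem_coe, mem_filter, mem_univ, true_and] at hQ
      simp only [mem_coe, mem_powersetCard]
      exact ⟨subset_univ _, by rw [card_sdiff_of_subset hQ.1.1]; exact hQ.2⟩
    · intro Q hQ Q' hQ' h
      simp only [mem_coe, mem_filter, mem_univ, true_and] at hQ hQ'
      simp only at h
      rw [← sdiff_union_of_subset hQ.1.1, h, sdiff_union_of_subset hQ'.1.1]
  refine (sum_le_card_nsmul _ _ _ hterm).trans ?_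
  rw [nsmul_eq_mul]
  calc _ ≤ (Fintype.card V : ℝ) ^ l / l.factorial * ((m.descFactorial #X : ℝ) *
        activity V ^ #X * (((m : ℝ) * activity V) ^ l * (15 / 16) ^ (m - s))) := by
        gcongr
    _ = (m.descFactorial #X : ℝ) * activity V ^ #X *
        (((m : ℝ) * (Fintype.card V * activity V)) ^ l / l.factorial * (15 / 16) ^ (m - s)) := by
        rw [mul_pow, mul_pow, mul_pow]; ring
    _ ≤ _ := by
        have h0 : 0 ≤ (Fintype.card V : ℝ) * activity V := by positivity
        have h1 : (m : ℝ) * (Fintype.card V * activity V) ≤ m := by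
          have := mul_le_mul_of_nonneg_left
            ((card_mul_activity_le (V := V)).trans (by norm_num : (1 : ℝ) / 4 ≤ 1))
            (Nat.cast_nonneg (α := ℝ) m)
          linarith
        gcongr

end ShearerMeasure

/-! ### Complete hypergraphs with edge weights close to one -/

section Gadget

theorem choose_succ_le_two_mul {a b : ℕ} (h : 2 * b ≤ a) : (a + 1).choose b ≤ 2 * a.choose b := by
  rcases b with _ | b
  · simp
  · rw [Nat.choose_succ_succ']
    have : a.choose b ≤ a.choose (b + 1) := Nat.choose_le_succ_of_lt_half_left (by omega)
    omega

theorem choose_add_le_two_pow_mul {a b : ℕ} (h : 2 * b ≤ a) (i : ℕ) :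
    (a + i).choose b ≤ 2 ^ i * a.choose b := by
  induction i with
  | zero => simp
  | succ i ih =>
    have := choose_succ_le_two_mul (a := a + i) (b := b) (by omega)
    rw [← add_assoc, pow_succ]; linarith

variable {V : Type*} [DecidableEq V]

theorem card_filter_powersetCard_between {T : Finset V} {q r : ℕ} {e U : Finset V}
    (he : e ⊆ T) (hec : #e = r) (hU : U ⊆ T) (hd : Disjoint e U) (hrq : r ≤ q) :
    #{P ∈ T.powersetCard q | e ⊆ P ∧ Disjoint U P} = (#T - #U - r).choose (q - r) := by
  have h1 : #((T \ U) \ e) = #T - #U - r := by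
    rw [card_sdiff_of_subset (subset_sdiff.2 ⟨he, hd⟩), card_sdiff_of_subset hU, hec]
  rw [← h1, ← card_powersetCard]
  refine card_bij' (fun P _ => P \ e) (fun P _ => P ∪ e) ?_ ?_ ?_ ?_
  · intro P hP
    simp only [mem_filter, mem_powersetCard] at hP ⊢
    obtain ⟨⟨ha, hb⟩, hc, hdj⟩ := hP
    exact ⟨sdiff_subset_sdiff (subset_sdiff.2 ⟨ha, hdj.symm⟩) subset_rfl,
      by rw [card_sdiff_of_subset hc, hb, hec]⟩
  · intro P hP
    simp only [mem_filter, mem_powersetCard] at hP ⊢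
    obtain ⟨ha, hb⟩ := hP
    rw [subset_sdiff, subset_sdiff] at ha
    refine ⟨⟨union_subset ha.1.1 he, ?_⟩, subset_union_right, ?_⟩
    · rw [card_union_of_disjoint ha.2, hb, hec]; omega
    · exact disjoint_union_right.2 ⟨ha.1.2.symm, hd.symm⟩
  · intro P hP
    simp only [mem_filter, mem_powersetCard] at hP
    exact sdiff_union_of_subset hP.2.1
  · intro P hP
    simp only [mem_powersetCard] at hP
    rw [subset_sdiff] at hP
    exact union_sdiff_cancel_right hP.1.2

/-- A signed weighting of the `q`-subsets `P` of a `k`-set that gives total weight `1` to the sets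
containing `e` and total weight `0` to those containing any other `r`-set. It is the combination,
by inclusion–exclusion over the sets `U ⊆ e`, of the uniform decompositions of the complete
`r`-graphs that avoid `U`. -/
noncomputable def edgeGadget (k q r : ℕ) (e P : Finset V) : ℝ :=
  ∑ U ∈ (e \ P).powerset, (-1) ^ #U / ((k - #U - r).choose (q - r) : ℝ)

theorem sum_edgeGadget {T : Finset V} {q r : ℕ} (hT : q + r ≤ #T) (hrq : r ≤ q)
    {e e' : Finset V} (he : e ∈ T.powersetCard r) (he' : e' ∈ T.powersetCard r) :
    ∑ P ∈ T.powersetCard q with e' ⊆ P, edgeGadget #T q r e P = if e = e' then 1 else 0 := by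
  rw [mem_powersetCard] at he he'
  have h1 : ∀ P : Finset V, edgeGadget #T q r e P = ∑ U ∈ e.powerset,
      if Disjoint U P then (-1) ^ #U / ((#T - #U - r).choose (q - r) : ℝ) else 0 := by
    intro P
    rw [edgeGadget, ← sum_filter]
    refine sum_congr ?_ fun _ _ => rfl
    ext U
    rw [mem_powerset, mem_filter, mem_powerset, subset_sdiff]
  simp_rw [h1]
  rw [sum_comm]
  have h2 : ∀ U ∈ e.powerset, (∑ P ∈ T.powersetCard q with e' ⊆ P,
      if Disjoint U P then (-1) ^ #U / ((#T - #U - r).choose (q - r) : ℝ) else 0) =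
      if Disjoint e' U then (-1) ^ #U else 0 := by
    intro U hU
    rw [mem_powerset] at hU
    rw [← sum_filter, filter_filter, sum_const, nsmul_eq_mul]
    split_ifs with hd
    · rw [card_filter_powersetCard_between he'.1 he'.2 (hU.trans he.1) hd hrq]
      have hUr : #U ≤ r := he.2 ▸ card_le_card hU
      have : ((#T - #U - r).choose (q - r) : ℝ) ≠ 0 := by
        exact_mod_cast (Nat.choose_pos (by omega)).ne'
      field_simp
    · rw [filter_eq_empty_iff.2, card_empty, Nat.cast_zero, zero_mul]
      rintro P _ ⟨ha, hb⟩
      exact hd (hb.mono_right ha).symm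
  rw [sum_congr rfl h2, ← sum_filter]
  have h3 : e.powerset.filter (fun U => Disjoint e' U) = (e \ e').powerset := by
    ext U
    rw [mem_filter, mem_powerset, mem_powerset, subset_sdiff, disjoint_comm]
  have h4 : e \ e' = ∅ ↔ e = e' := by
    rw [sdiff_eq_empty_iff_subset]
    exact ⟨fun h => eq_of_subset_of_card_le h (by rw [he.2, he'.2]), fun h => h.subset⟩
  have h5 := sum_powerset_neg_one_pow_card (x := e \ e')
  simp only [h4] at h5
  rw [h3]
  exact_mod_cast h5

theorem abs_edgeGadget_le {k q r : ℕ} (hk : 2 * q ≤ k) (hrq : r ≤ q) {e : Finset V} (he : #e = r)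
    (P : Finset V) : |edgeGadget k q r e P| ≤ 4 ^ r / ((k - r).choose (q - r) : ℝ) := by
  have hpos : (0 : ℝ) < (k - r).choose (q - r) := by
    exact_mod_cast Nat.choose_pos (by omega)
  have h1 : ∀ U ∈ (e \ P).powerset, |(-1) ^ #U / ((k - #U - r).choose (q - r) : ℝ)| ≤
      2 ^ r / ((k - r).choose (q - r) : ℝ) := by
    intro U hU
    have hUr : #U ≤ r := he ▸ card_le_card ((mem_powerset.1 hU).trans sdiff_subset)
    have hposU : (0 : ℝ) < (k - #U - r).choose (q - r) := by
      exact_mod_cast Nat.choose_pos (by omega)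
    rw [abs_div, abs_pow, abs_neg, abs_one, one_pow, abs_of_pos hposU,
      div_le_div_iff₀ hposU hpos, one_mul]
    have h := choose_add_le_two_pow_mul (a := k - #U - r) (b := q - r) (by omega) #U
    rw [show k - #U - r + #U = k - r by omega] at h
    calc ((k - r).choose (q - r) : ℝ) ≤ 2 ^ #U * (k - #U - r).choose (q - r) := by
          exact_mod_cast h
      _ ≤ _ := by gcongr; norm_num
  calc |edgeGadget k q r e P| ≤ ∑ U ∈ (e \ P).powerset, 2 ^ r / ((k - r).choose (q - r) : ℝ) :=
        (abs_sum_le_sum_abs _ _).trans (sum_le_sum h1)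
    _ ≤ 2 ^ r * (2 ^ r / ((k - r).choose (q - r) : ℝ)) := by
        rw [sum_const, nsmul_eq_mul, card_powerset]
        gcongr
        push_cast
        have : #(e \ P) ≤ r := he ▸ card_le_card sdiff_subset
        gcongr
        norm_num
    _ = _ := by rw [← mul_div_assoc, ← mul_pow]; norm_num

/-- The complete `r`-graph on at least `2 * q` vertices, with edge weights close to `1`, is a
non-negative combination of complete `r`-graphs on `q` vertices. -/
theorem exists_weighting_of_near_one {T : Finset V} {q r : ℕ} (hT : 2 * q ≤ #T) (hrq : r ≤ q)
    (x : Finset V → ℝ) {δ : ℝ} (hx : ∀ e ∈ T.powersetCard r, |x e - 1| ≤ δ)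
    (hδ : δ * (4 ^ r * (#T).choose r) ≤ 1) :
    ∃ Φ : Finset V → ℝ, (∀ P, 0 ≤ Φ P) ∧
      ∀ e ∈ T.powersetCard r, ∑ P ∈ T.powersetCard q with e ⊆ P, Φ P = x e := by
  have hpos : (0 : ℝ) < (#T - r).choose (q - r) := by
    exact_mod_cast Nat.choose_pos (by omega)
  refine ⟨fun P => 1 / ((#T - r).choose (q - r) : ℝ) +
    ∑ e ∈ T.powersetCard r, (x e - 1) * edgeGadget #T q r e P, fun P => ?_, fun e he => ?_⟩
  · have h1 : |∑ e ∈ T.powersetCard r, (x e - 1) * edgeGadget #T q r e P| ≤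
        1 / ((#T - r).choose (q - r) : ℝ) := by
      calc _ ≤ ∑ e ∈ T.powersetCard r, δ * (4 ^ r / ((#T - r).choose (q - r) : ℝ)) := by
            refine (abs_sum_le_sum_abs _ _).trans (sum_le_sum fun e he => ?_)
            rw [abs_mul]
            exact mul_le_mul (hx e he) (abs_edgeGadget_le hT hrq (mem_powersetCard.1 he).2 P)
              (abs_nonneg _) ((abs_nonneg _).trans (hx e he))
        _ = δ * (4 ^ r * (#T).choose r) / ((#T - r).choose (q - r) : ℝ) := by
            rw [sum_const, nsmul_eq_mul, card_powersetCard]; ring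
        _ ≤ _ := by gcongr
    have := (abs_le.1 h1).1
    dsimp only
    linarith
  · have he' := mem_powersetCard.1 he
    have hcard := card_filter_powersetCard_between (q := q) he'.1 he'.2 (empty_subset T)
      (disjoint_empty_right e) hrq
    simp only [disjoint_empty_left, and_true, card_empty, Nat.sub_zero] at hcard
    rw [sum_add_distrib, sum_const, nsmul_eq_mul, hcard, sum_comm,
      mul_one_div_cancel hpos.ne']
    have h2 : ∀ f ∈ T.powersetCard r, ∑ P ∈ T.powersetCard q with e ⊆ P,
        (x f - 1) * edgeGadget #T q r f P = if f = e then x f - 1 else 0 := by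
      intro f hf
      rw [← mul_sum, sum_edgeGadget (by omega) hrq hf he]
      split_ifs <;> simp
    rw [sum_congr rfl h2, sum_ite_eq', if_pos he]
    ring

end Gadget

/-! ### The missing sets of a hypergraph -/

section Missing

theorem sum_powersetCard_prod_le_pow {α : Type*} [DecidableEq α] (s : Finset α) (f : α → ℝ)
    (hf : ∀ a, 0 ≤ f a) (k : ℕ) :
    ∑ S ∈ s.powersetCard k, ∏ a ∈ S, f a ≤ (∑ a ∈ s, f a) ^ k := by
  induction k with
  | zero => simp
  | succ k ih =>
    have hs : 0 ≤ ∑ a ∈ s, f a := sum_nonneg fun a _ => hf a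
    have hne : ∀ S : {S // S ∈ s.powersetCard (k + 1)}, ∃ a, a ∈ S.1 := fun S => by
      have := (mem_powersetCard.1 S.2).2
      exact card_pos.1 (by omega)
    choose g hg using hne
    -- send `S` to the pair of an element of `S` and the rest of `S`
    calc ∑ S ∈ s.powersetCard (k + 1), ∏ a ∈ S, f a
        = ∑ S ∈ (s.powersetCard (k + 1)).attach, ∏ a ∈ S.1, f a := (sum_attach _ _).symm
      _ = ∑ S ∈ (s.powersetCard (k + 1)).attach,
          (fun p : α × Finset α => f p.1 * ∏ a ∈ p.2, f a) (g S, S.1.erase (g S)) := by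
          refine sum_congr rfl fun S _ => ?_
          exact (mul_prod_erase _ _ (hg S)).symm
      _ = ∑ p ∈ (s.powersetCard (k + 1)).attach.image (fun S => (g S, S.1.erase (g S))),
          f p.1 * ∏ a ∈ p.2, f a := by
          rw [sum_image]
          intro S _ S' _ h
          simp only [Prod.mk.injEq] at h
          refine Subtype.ext ?_
          rw [← insert_erase (hg S), ← insert_erase (hg S'), h.2, h.1]
      _ ≤ ∑ p ∈ s ×ˢ s.powersetCard k, f p.1 * ∏ a ∈ p.2, f a := by
          refine sum_le_sum_of_subset_of_nonneg ?_ fun p _ _ =>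
            mul_nonneg (hf _) (prod_nonneg fun a _ => hf a)
          intro p hp
          obtain ⟨S, -, rfl⟩ := mem_image.1 hp
          have hS := mem_powersetCard.1 S.2
          rw [mem_product, mem_powersetCard]
          exact ⟨hS.1 (hg S), (erase_subset _ _).trans hS.1,
            by rw [card_erase_of_mem (hg S), hS.2]; rfl⟩
      _ = (∑ a ∈ s, f a) * ∑ S ∈ s.powersetCard k, ∏ a ∈ S, f a := by
          rw [sum_product, sum_mul_sum]
      _ ≤ (∑ a ∈ s, f a) ^ (k + 1) := by
          rw [pow_succ']; gcongr

namespace RGraph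

variable {V : Type*} [Fintype V] [DecidableEq V] {r : ℕ}

/-- The `r`-sets of vertices that are not edges. The independent sets of this family are the
vertex sets of complete `r`-graphs in `G`. -/
def missing (G : RGraph V r) : Finset (Finset V) :=
  (univ.powersetCard r).filter (· ∉ G.edges)

theorem isIndep_missing {G : RGraph V r} {X : Finset V} :
    IsIndep G.missing X ↔ ∀ e ∈ X.powersetCard r, e ∈ G.edges := by
  constructor
  · intro h e he
    rw [mem_powersetCard] at he
    by_contra hne
    exact h e (mem_filter.2 ⟨mem_powersetCard.2 ⟨subset_univ _, he.2⟩, hne⟩) he.1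
  · intro h F hF hFX
    rw [missing, mem_filter, mem_powersetCard] at hF
    exact hF.2 (h F (mem_powersetCard.2 ⟨hFX, hF.1.2⟩))

theorem isIndep_missing_edge {G : RGraph V r} {e : Finset V} (he : e ∈ G.edges) :
    IsIndep G.missing e := by
  rw [isIndep_missing]
  intro f hf
  rw [mem_powersetCard] at hf
  rwa [eq_of_subset_of_card_le hf.1 (by rw [G.card_edge e he, hf.2])]

/-- The vertices that do not form an edge together with `S`. -/
def nonExtensions (G : RGraph V r) (S : Finset V) : Finset V :=
  Sᶜ.filter (fun u => insert u S ∉ G.edges)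

theorem degree_eq_card {G : RGraph V r} {S : Finset V} (hS : #S + 1 = r) :
    G.degree S = #{u ∈ Sᶜ | insert u S ∈ G.edges} := by
  symm
  refine card_bij (fun u _ => insert u S) ?_ ?_ ?_
  · intro u hu
    rw [mem_filter] at hu ⊢
    exact ⟨hu.2, subset_insert _ _⟩
  · intro u hu v hv h
    rw [mem_filter, mem_compl] at hu hv
    have : u ∈ insert v S := h ▸ mem_insert_self u S
    rcases mem_insert.1 this with h' | h'
    · exact h'
    · exact absurd h' hu.1
  · intro e he
    rw [mem_filter] at he
    have hc : #(e \ S) = 1 := by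
      rw [card_sdiff_of_subset he.2, G.card_edge e he.1]; omega
    obtain ⟨u, hu⟩ := card_eq_one.1 hc
    have hu' : u ∈ e \ S := hu ▸ mem_singleton_self u
    have heq : insert u S = e := by
      rw [insert_eq, ← hu, sdiff_union_of_subset he.2]
    exact ⟨u, mem_filter.2 ⟨mem_compl.2 (mem_sdiff.1 hu').2, heq ▸ he.1⟩, heq⟩

theorem card_nonExtensions_add {G : RGraph V r} {S : Finset V} (hS : #S + 1 = r) :
    #(G.nonExtensions S) + G.minCodegree + #S ≤ Fintype.card V := by
  have h1 : G.minCodegree ≤ G.degree S :=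
    ciInf_le (OrderBot.bddBelow _) (⟨S, hS⟩ : {S : Finset V // S.card + 1 = r})
  have h2 : #{u ∈ Sᶜ | insert u S ∈ G.edges} + #(G.nonExtensions S) = #Sᶜ :=
    card_filter_add_card_filter_not _
  have h3 := card_add_card_compl S
  rw [degree_eq_card hS] at h1
  omega

variable {G : RGraph V r} {d : ℝ} {m : ℕ}

/-- The `(k + 1)`-sets through a vertex of `Q` have small total weight, where each vertex outside `Q`
costs a factor `m / |V|`: apart from that vertex, each position has total weight at most `2 * m`. -/
theorem sum_pow_card_sdiff_le (k : ℕ) (v : V) {Q : Finset V} (hv : v ∈ Q) (hQ : #Q ≤ m) :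
    ∑ S ∈ univ.powersetCard (k + 1) with v ∈ S, ((m : ℝ) / Fintype.card V) ^ #(S \ Q) ≤
      (2 * m) ^ k := by
  set y := (m : ℝ) / Fintype.card V with hy
  have hy0 : 0 ≤ y := by positivity
  calc _ = ∑ S ∈ (univ.erase v).powersetCard k, y ^ #(S \ Q) := by
        refine sum_bij' (fun S _ => S.erase v) (fun S _ => insert v S) ?_ ?_ ?_ ?_ ?_
        · intro S hS
          simp only [mem_filter, mem_powersetCard] at hS ⊢
          exact ⟨erase_subset_erase v (subset_univ S), by
            rw [card_erase_of_mem hS.2, hS.1.2]; rfl⟩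
        · intro S hS
          simp only [mem_filter, mem_powersetCard] at hS ⊢
          refine ⟨⟨subset_univ _, ?_⟩, mem_insert_self _ _⟩
          rw [card_insert_of_notMem fun h => notMem_erase v univ (hS.1 h), hS.2]
        · intro S hS
          exact insert_erase (mem_filter.1 hS).2
        · intro S hS
          exact erase_insert fun h => notMem_erase v univ ((mem_powersetCard.1 hS).1 h)
        · intro S hS
          rw [erase_sdiff_comm, erase_eq_of_notMem]
          exact fun h => (mem_sdiff.1 h).2 hv
    _ = ∑ S ∈ (univ.erase v).powersetCard k, ∏ u ∈ S, if u ∈ Q then 1 else y := by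
        refine sum_congr rfl fun S _ => ?_
        rw [prod_ite, prod_const_one, one_mul, prod_const, sdiff_eq_filter]
    _ ≤ (∑ u ∈ univ.erase v, if u ∈ Q then 1 else y) ^ k :=
        sum_powersetCard_prod_le_pow _ _ (fun u => by split_ifs <;> positivity) k
    _ ≤ (2 * m) ^ k := by
        refine pow_le_pow_left₀ (sum_nonneg fun u _ => by split_ifs <;> positivity) ?_ k
        calc ∑ u ∈ univ.erase v, (if u ∈ Q then 1 else y)
            ≤ ∑ u, ((if u ∈ Q then 1 else 0) + y) := by
              refine (sum_le_sum fun u _ => ?_).trans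
                (sum_le_sum_of_subset_of_nonneg (subset_univ _) fun u _ _ => by
                  split_ifs <;> positivity)
              split_ifs <;> linarith
          _ = #Q + Fintype.card V * y := by
              rw [sum_add_distrib, sum_const, nsmul_eq_mul, card_univ, sum_boole]
              simp
          _ ≤ m + m := by
              have h1 : (#Q : ℝ) ≤ m := by exact_mod_cast hQ
              have h2 : Fintype.card V * y ≤ m := by
                have hn : (Fintype.card V : ℝ) ≠ 0 :=
                  Nat.cast_ne_zero.2 (Fintype.card_pos_iff.2 ⟨v⟩).ne'
                rw [hy, mul_div_cancel₀ _ hn]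
              linarith
          _ = _ := by ring

/-- If every `(r - 1)`-set has few non-extensions, the family of missing sets is sparse. The last
vertex of a missing set contributes a factor of at most `d * (m / |V|)`, and each of the remaining
`r - 2` free vertices contributes at most `2 * m`. -/
theorem isSparse_missing (hr : 2 ≤ r)
    (hd : ∀ S : Finset V, #S + 1 = r → (#(G.nonExtensions S) : ℝ) ≤ d) (hd0 : 0 ≤ d)
    (hm : 8 * (m : ℝ) ≤ Fintype.card V)
    (hdm : 8 * (d * (2 * m) ^ (r - 1)) ≤ Fintype.card V) : IsSparse G.missing m := by
  refine ⟨hm, fun Q v hQ => ?_⟩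
  have hm1 : (1 : ℝ) ≤ m := by exact_mod_cast (by omega : 1 ≤ m)
  have hn : 0 < (Fintype.card V : ℝ) := by linarith
  set Q' := insert v Q with hQ'
  have hvQ : v ∈ Q' := mem_insert_self v Q
  have hQm : #Q' ≤ m := (card_insert_le v Q).trans hQ
  set y := (m : ℝ) / Fintype.card V with hy
  have hy0 : 0 ≤ y := by positivity
  obtain ⟨k, rfl⟩ : ∃ k, r = k + 2 := ⟨r - 2, by omega⟩
  set 𝓣 := G.missing.filter (fun F => v ∈ F ∧ ¬ F ⊆ Q') with h𝓣
  have hne : ∀ F : {F // F ∈ 𝓣}, ∃ u, u ∈ F.1 \ Q' := fun F =>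
    sdiff_nonempty.2 (mem_filter.1 F.2).2.2
  choose g hg using hne
  set 𝓢 := (univ.powersetCard (k + 1)).filter (fun S : Finset V => v ∈ S) with h𝓢
  -- a missing set `F` is determined by a vertex of `F \ Q'` and the rest of `F`
  calc ∑ F ∈ 𝓣, y ^ #(F \ Q') = ∑ F ∈ 𝓣.attach, y ^ #(F.1 \ Q') := (sum_attach _ _).symm
    _ = ∑ F ∈ 𝓣.attach, (fun p : (_ : Finset V) × V => y * y ^ #(p.1 \ Q'))
          ⟨F.1.erase (g F), g F⟩ := by
        refine sum_congr rfl fun F _ => ?_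
        simp only
        rw [erase_sdiff_comm, ← pow_succ', card_erase_add_one (hg F)]
    _ = ∑ p ∈ 𝓣.attach.image (fun F => (⟨F.1.erase (g F), g F⟩ : (_ : Finset V) × V)),
          y * y ^ #(p.1 \ Q') := by
        rw [sum_image]
        intro F _ F' _ h
        simp only [Sigma.mk.injEq, heq_eq_eq] at h
        refine Subtype.ext ?_
        rw [← insert_erase (mem_sdiff.1 (hg F)).1, ← insert_erase (mem_sdiff.1 (hg F')).1,
          h.1, h.2]
    _ ≤ ∑ p ∈ 𝓢.sigma fun S => G.nonExtensions S, y * y ^ #(p.1 \ Q') := by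
        refine sum_le_sum_of_subset_of_nonneg ?_ fun p _ _ => by positivity
        intro p hp
        obtain ⟨F, -, rfl⟩ := mem_image.1 hp
        have hF := mem_filter.1 F.2
        have hF1 := mem_filter.1 hF.1
        have hgF := mem_sdiff.1 (hg F)
        rw [mem_sigma, h𝓢, mem_filter, mem_powersetCard]
        refine ⟨⟨⟨subset_univ _, ?_⟩, ?_⟩, ?_⟩
        · rw [card_erase_of_mem hgF.1, (mem_powersetCard.1 hF1.1).2]; rfl
        · exact mem_erase.2 ⟨fun h => hgF.2 (h ▸ hvQ), hF.2.1⟩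
        · rw [nonExtensions, mem_filter, mem_compl, insert_erase hgF.1]
          exact ⟨notMem_erase _ _, hF1.2⟩
    _ = ∑ S ∈ 𝓢, #(G.nonExtensions S) * (y * y ^ #(S \ Q')) := by
        rw [sum_sigma]
        exact sum_congr rfl fun S _ => by simp only [sum_const, nsmul_eq_mul]
    _ ≤ ∑ S ∈ 𝓢, d * (y * y ^ #(S \ Q')) := by
        refine sum_le_sum fun S hS => ?_
        have := hd S (by rw [(mem_powersetCard.1 (mem_filter.1 hS).1).2])
        gcongr
    _ = d * y * ∑ S ∈ 𝓢, y ^ #(S \ Q') := by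
        rw [mul_sum]; exact sum_congr rfl fun S _ => by ring
    _ ≤ d * y * (2 * m) ^ k := by
        exact mul_le_mul_of_nonneg_left (sum_pow_card_sdiff_le k v hvQ hQm) (by positivity)
    _ ≤ 1 / 8 := by
        rw [hy, mul_div_assoc', div_mul_eq_mul_div, div_le_div_iff₀ hn (by norm_num)]
        rw [show k + 2 - 1 = k + 1 by omega, pow_succ] at hdm
        have : 0 ≤ d * m * (2 * m) ^ k := by positivity
        linarith

/-- At least half of all vertices extend a given clique with fewer than `m` vertices. -/
theorem half_card_le_extensions (hr : 2 ≤ r)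
    (hd : ∀ S : Finset V, #S + 1 = r → (#(G.nonExtensions S) : ℝ) ≤ d) (hd0 : 0 ≤ d)
    (hm : 8 * (m : ℝ) ≤ Fintype.card V)
    (hdm : 8 * (d * (2 * m) ^ (r - 1)) ≤ Fintype.card V) {Q : Finset V}
    (hi : IsIndep G.missing Q) (hQ : #Q < m) :
    (Fintype.card V : ℝ) / 2 ≤ #{v ∈ Qᶜ | IsIndep G.missing (insert v Q)} := by
  have hbad : Qᶜ.filter (fun v => ¬ IsIndep G.missing (insert v Q)) ⊆
      (Q.powersetCard (r - 1)).biUnion G.nonExtensions := by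
    intro v hv
    rw [mem_filter, mem_compl, isIndep_missing] at hv
    obtain ⟨hvQ, hv⟩ := hv
    push Not at hv
    obtain ⟨F, hF, hFG⟩ := hv
    rw [mem_powersetCard] at hF
    have hvF : v ∈ F := by
      by_contra h
      rw [isIndep_missing] at hi
      exact hFG (hi F (mem_powersetCard.2 ⟨(subset_insert_iff_of_notMem h).1 hF.1, hF.2⟩))
    rw [mem_biUnion]
    refine ⟨F.erase v, mem_powersetCard.2 ⟨subset_insert_iff.1 hF.1, ?_⟩, ?_⟩
    · rw [card_erase_of_mem hvF, hF.2]
    · rw [nonExtensions, mem_filter, mem_compl, insert_erase hvF]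
      exact ⟨notMem_erase _ _, hFG⟩
  have h1 : (#(Qᶜ.filter fun v => ¬ IsIndep G.missing (insert v Q)) : ℝ) ≤
      d * (2 * m) ^ (r - 1) := by
    calc (#(Qᶜ.filter fun v => ¬ IsIndep G.missing (insert v Q)) : ℝ)
        ≤ ∑ S ∈ Q.powersetCard (r - 1), (#(G.nonExtensions S) : ℝ) := by
          exact_mod_cast (card_le_card hbad).trans card_biUnion_le
      _ ≤ ∑ S ∈ Q.powersetCard (r - 1), d := by
          refine sum_le_sum fun S hS => hd S ?_
          rw [(mem_powersetCard.1 hS).2]; omega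
      _ = (#Q).choose (r - 1) * d := by
          rw [sum_const, nsmul_eq_mul, card_powersetCard]
      _ ≤ (2 * m) ^ (r - 1) * d := by
          gcongr
          calc ((#Q).choose (r - 1) : ℝ) ≤ (#Q : ℝ) ^ (r - 1) := by
                exact_mod_cast Nat.choose_le_pow _ _
            _ ≤ _ := by
                have : (#Q : ℝ) ≤ m := by exact_mod_cast hQ.le
                gcongr
                linarith [Nat.cast_nonneg (α := ℝ) m]
      _ = _ := mul_comm _ _
  have h2 : (#{v ∈ Qᶜ | IsIndep G.missing (insert v Q)} : ℝ) +
      #(Qᶜ.filter fun v => ¬ IsIndep G.missing (insert v Q)) = #Qᶜ := by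
    exact_mod_cast card_filter_add_card_filter_not _
  have h3 : (#Q : ℝ) + #Qᶜ = Fintype.card V := by exact_mod_cast card_add_card_compl Q
  have h4 : (#Q : ℝ) ≤ m := by exact_mod_cast hQ.le
  linarith

end RGraph

end Missing

/-! ### From Shearer's measure to fractional decompositions -/

section Threshold

/-- The loss from the sets with fewer than `2 * q` vertices is negligible if `m = M * q`. -/
theorem exists_slots_factor (r : ℕ) :
    ∃ M : ℕ, 2 ≤ M ∧ ∀ q : ℕ, 0 < q →
      (∑ l ∈ range (2 * q), ((M * q : ℕ) : ℝ) ^ l / l.factorial) *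
        (15 / 16) ^ (M * q - 2 * q) * (2 * (4 ^ r * ((M * q : ℕ) : ℝ) ^ r)) ≤ 1 := by
  have hlim : Filter.Tendsto (fun M : ℕ => (6 * 8 ^ r : ℝ) * (16 / 15) ^ 2 *
      ((M : ℝ) ^ (r + 2) * (15 / 16) ^ M)) Filter.atTop (nhds 0) := by
    have := (tendsto_pow_const_mul_const_pow_of_abs_lt_one (r + 2)
      (r := (15 / 16 : ℝ)) (by rw [abs_of_pos] <;> norm_num)).const_mul
      ((6 * 8 ^ r : ℝ) * (16 / 15) ^ 2)
    rwa [mul_zero] at this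
  obtain ⟨M, hM2, hM⟩ := ((Filter.eventually_ge_atTop 2).and
    (hlim.eventually (gt_mem_nhds one_pos))).exists
  refine ⟨M, hM2, fun q hq => ?_⟩
  have hM1 : (1 : ℝ) ≤ M := by exact_mod_cast (by omega : 1 ≤ M)
  have hq2 : (q : ℝ) ≤ 2 ^ q := by exact_mod_cast Nat.lt_two_pow_self.le
  have hsum : ∑ l ∈ range (2 * q), ((M * q : ℕ) : ℝ) ^ l / l.factorial ≤
      (M : ℝ) ^ (2 * q) * 3 ^ q := by
    calc _ ≤ ∑ l ∈ range (2 * q), (M : ℝ) ^ (2 * q) * ((q : ℝ) ^ l / l.factorial) := by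
          refine sum_le_sum fun l hl => ?_
          push_cast
          rw [mul_pow, mul_div_assoc]
          have := (mem_range.1 hl).le
          gcongr
      _ ≤ (M : ℝ) ^ (2 * q) * Real.exp q := by
          rw [← mul_sum]
          gcongr
          exact Real.sum_le_exp_of_nonneg (by positivity) _
      _ ≤ (M : ℝ) ^ (2 * q) * 3 ^ q := by
          rw [← Real.exp_one_pow q]
          gcongr
          exact Real.exp_one_lt_three.le
  have hsub : (15 / 16 : ℝ) ^ (M * q - 2 * q) = ((15 / 16) ^ M * (16 / 15) ^ 2) ^ q := by
    obtain ⟨N, rfl⟩ := Nat.exists_eq_add_of_le hM2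
    rw [show (2 + N) * q - 2 * q = N * q by rw [add_mul]; omega, pow_add, pow_mul]
    congr 1
    rw [mul_right_comm, ← mul_pow]
    norm_num
  have hr1 : 2 * (4 ^ r * ((M * q : ℕ) : ℝ) ^ r) ≤ (2 * 8 ^ r * (M : ℝ) ^ r) ^ q := by
    have h1 : (1 : ℝ) ≤ 2 * 4 ^ r * (M : ℝ) ^ r := by
      have h2 : (1 : ℝ) ≤ 4 ^ r := one_le_pow₀ (by norm_num)
      have h3 : (1 : ℝ) ≤ (M : ℝ) ^ r := one_le_pow₀ hM1
      nlinarith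
    calc 2 * (4 ^ r * ((M * q : ℕ) : ℝ) ^ r) = 2 * 4 ^ r * (M : ℝ) ^ r * (q : ℝ) ^ r := by
          push_cast; rw [mul_pow]; ring
      _ ≤ (2 * 4 ^ r * (M : ℝ) ^ r) ^ q * (2 ^ q) ^ r := by
          gcongr
          exact le_self_pow₀ h1 hq.ne'
      _ = (2 * (4 * 2) ^ r * (M : ℝ) ^ r) ^ q := by
          rw [← pow_mul, mul_comm q r, pow_mul, ← mul_pow, mul_pow 4 2 r]; ring
      _ = _ := by norm_num
  calc _ ≤ (M : ℝ) ^ (2 * q) * 3 ^ q * ((15 / 16) ^ M * (16 / 15) ^ 2) ^ q *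
        (2 * 8 ^ r * (M : ℝ) ^ r) ^ q := by
        rw [hsub]; gcongr
    _ = ((M : ℝ) ^ 2 * 3 * ((15 / 16) ^ M * (16 / 15) ^ 2) * (2 * 8 ^ r * (M : ℝ) ^ r)) ^ q := by
        rw [pow_mul, ← mul_pow, ← mul_pow, ← mul_pow]
    _ ≤ 1 := by
        refine pow_le_one₀ (by positivity) ?_
        calc _ = (6 * 8 ^ r : ℝ) * (16 / 15) ^ 2 * ((M : ℝ) ^ (r + 2) * (15 / 16) ^ M) := by
              rw [pow_add]; ring
          _ ≤ 1 := hM.le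

namespace RGraph

variable {V : Type*} [Fintype V] [DecidableEq V] {r : ℕ}

/-- A measure on the cliques with at least `2 * q` and at most `m` vertices that covers every edge
with weight close to `1` can be turned into a fractional `K_q^r`-decomposition: the weight of each
clique is distributed over its `q`-subsets, where the edges receive the factors that correct the
covering weights to `1`. -/
theorem hasFractionalDecomposition_of_cover (G : RGraph V r) {q m : ℕ} (hrq : r ≤ q)
    (w : Finset V → ℝ) (hw : ∀ Q, 0 ≤ w Q) (hwm : ∀ Q, m < #Q → w Q = 0)
    (hwi : ∀ Q, ¬ IsIndep G.missing Q → w Q = 0) {δ : ℝ}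
    (hδ : 2 * δ * (4 ^ r * (m : ℝ) ^ r) ≤ 1) (hδ2 : δ ≤ 1 / 2)
    (hcov : ∀ e ∈ G.edges, |∑ Q with e ⊆ Q ∧ 2 * q ≤ #Q, w Q - 1| ≤ δ) :
    G.HasFractionalDecomposition q := by
  set 𝓠 : Finset (Finset V) :=
    univ.filter (fun Q => 2 * q ≤ #Q ∧ #Q ≤ m ∧ IsIndep G.missing Q) with h𝓠
  have hcov' : ∀ e, ∑ Q ∈ 𝓠 with e ⊆ Q, w Q = ∑ Q with e ⊆ Q ∧ 2 * q ≤ #Q, w Q := by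
    intro e
    refine sum_subset ?_ ?_
    · intro Q hQ
      simp only [h𝓠, mem_filter, mem_univ, true_and] at hQ ⊢
      exact ⟨hQ.2, hQ.1.1⟩
    · intro Q hQ hQn
      simp only [h𝓠, mem_filter, mem_univ, true_and] at hQ hQn
      by_cases h1 : IsIndep G.missing Q
      · exact hwm Q (by by_contra h; exact hQn ⟨⟨hQ.2, by omega, h1⟩, hQ.1⟩)
      · exact hwi Q h1
  set x : Finset V → ℝ := fun e => (∑ Q ∈ 𝓠 with e ⊆ Q, w Q)⁻¹ with hx
  have hc : ∀ e ∈ G.edges, 1 / 2 ≤ ∑ Q ∈ 𝓠 with e ⊆ Q, w Q := by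
    intro e he
    have := (abs_le.1 (hcov e he)).1
    rw [hcov']; linarith
  have hx1 : ∀ e ∈ G.edges, |x e - 1| ≤ 2 * δ := by
    intro e he
    have h1 := hc e he
    have h2 := hcov e he
    rw [← hcov'] at h2
    simp only [hx]
    set c := ∑ Q ∈ 𝓠 with e ⊆ Q, w Q
    have h3 : c⁻¹ - 1 = - (c - 1) * c⁻¹ := by field_simp; ring
    have hc0 : 0 < c := by linarith
    have h4 : c⁻¹ ≤ 2 := by
      rw [inv_le_comm₀ hc0 two_pos]; linarith
    rw [h3, abs_mul, abs_neg, abs_of_pos (inv_pos.2 hc0)]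
    calc |c - 1| * c⁻¹ ≤ δ * 2 := by
          gcongr
          exact (abs_nonneg _).trans h2
      _ = _ := mul_comm _ _
  have hΦ : ∀ Q ∈ 𝓠, ∃ Φ : Finset V → ℝ, (∀ P, 0 ≤ Φ P) ∧
      ∀ e ∈ Q.powersetCard r, ∑ P ∈ Q.powersetCard q with e ⊆ P, Φ P = x e := by
    intro Q hQ
    simp only [h𝓠, mem_filter, mem_univ, true_and] at hQ
    refine exists_weighting_of_near_one hQ.1 hrq x (δ := 2 * δ)
      (fun e he => hx1 e (isIndep_missing.1 hQ.2.2 e he)) ?_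
    rcases le_or_gt δ 0 with h | h
    · have : 2 * δ * (4 ^ r * ((#Q).choose r : ℝ)) ≤ 0 :=
        mul_nonpos_of_nonpos_of_nonneg (by linarith) (by positivity)
      linarith
    · refine le_trans ?_ hδ
      gcongr
      calc ((#Q).choose r : ℝ) ≤ (#Q : ℝ) ^ r := by exact_mod_cast Nat.choose_le_pow _ _
        _ ≤ _ := by
          have : (#Q : ℝ) ≤ m := by exact_mod_cast hQ.2.1
          gcongr
  choose! Φ hΦ0 hΦ1 using hΦ
  refine ⟨fun P => ∑ Q ∈ 𝓠 with P ⊆ Q, w Q * Φ Q P, fun P _ => ?_, fun e he => ?_⟩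
  · exact sum_nonneg fun Q hQ => mul_nonneg (hw Q) (hΦ0 Q (mem_filter.1 hQ).1 P)
  · calc ∑ P ∈ G.cliques q with e ⊆ P, ∑ Q ∈ 𝓠 with P ⊆ Q, w Q * Φ Q P
        = ∑ Q ∈ 𝓠 with e ⊆ Q, ∑ P ∈ Q.powersetCard q with e ⊆ P, w Q * Φ Q P := by
          refine sum_comm' fun P Q => ?_
          simp only [cliques, mem_filter, mem_univ, true_and, h𝓠, mem_powersetCard]
          constructor
          · rintro ⟨⟨⟨h1, h2⟩, h3⟩, h4, h5⟩
            exact ⟨⟨⟨h5, h1⟩, h3⟩, h4, h3.trans h5⟩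
          · rintro ⟨⟨⟨h5, h1⟩, h3⟩, h4, h6⟩
            refine ⟨⟨⟨h1, fun f hf => ?_⟩, h3⟩, h4, h5⟩
            exact isIndep_missing.1 h4.2.2 f
              (mem_powersetCard.2 ⟨hf.1.trans h5, hf.2⟩)
      _ = ∑ Q ∈ 𝓠 with e ⊆ Q, w Q * x e := by
          refine sum_congr rfl fun Q hQ => ?_
          rw [mem_filter] at hQ
          rw [← mul_sum, hΦ1 Q hQ.1 e (mem_powersetCard.2 ⟨hQ.2, G.card_edge e he⟩)]
      _ = 1 := by
          rw [← sum_mul]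
          exact mul_inv_cancel₀ (by linarith [hc e he])

/-- The existence of a fractional decomposition, in terms of the number `d` of vertices that do not
form an edge with a given `(r - 1)`-set. -/
theorem hasFractionalDecomposition_of_nonExtensions_le (G : RGraph V r) (hr : 2 ≤ r) {q m : ℕ}
    (hrq : r ≤ q) (hqm : 2 * q ≤ m) {d : ℝ} (hd0 : 0 ≤ d)
    (hd : ∀ S : Finset V, #S + 1 = r → (#(G.nonExtensions S) : ℝ) ≤ d)
    (hm : 8 * (m : ℝ) ≤ Fintype.card V)
    (hdm : 8 * (d * (2 * m) ^ (r - 1)) ≤ Fintype.card V)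
    (htail : (∑ l ∈ range (2 * q), (m : ℝ) ^ l / l.factorial) * (15 / 16) ^ (m - 2 * q) *
      (2 * (4 ^ r * (m : ℝ) ^ r)) ≤ 1) :
    G.HasFractionalDecomposition q := by
  have hsp := isSparse_missing hr hd hd0 hm hdm
  have hext := fun (Q : Finset V) (hi : IsIndep G.missing Q) (hQ : #Q < m) =>
    half_card_le_extensions hr hd hd0 hm hdm hi hQ
  have hm1 : (1 : ℝ) ≤ m := by exact_mod_cast (by omega : 1 ≤ m)
  have hn : 0 < (Fintype.card V : ℝ) := by linarith
  have ha : 0 < activity V := by unfold activity; positivity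
  set p : ℝ := (m.descFactorial r : ℝ) * activity V ^ r with hp
  have hp0 : 0 < p := by
    have : 0 < m.descFactorial r := Nat.descFactorial_pos.2 (by omega)
    positivity
  set δ := (∑ l ∈ range (2 * q), (m : ℝ) ^ l / l.factorial) * (15 / 16) ^ (m - 2 * q) with hδ
  have hδ0 : 0 ≤ δ := by
    have : 0 ≤ ∑ l ∈ range (2 * q), (m : ℝ) ^ l / l.factorial :=
      sum_nonneg fun l _ => by positivity
    positivity
  refine G.hasFractionalDecomposition_of_cover (m := m) (δ := δ) hrq
    (fun Q => shearerWeight G.missing m Q / p)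
    (fun Q => div_nonneg (hsp.shearerWeight_nonneg Q) hp0.le)
    (fun Q hQ => by rw [shearerWeight_of_lt hQ, zero_div])
    (fun Q hQ => by rw [shearerWeight_of_not_isIndep hQ, zero_div]) (by linarith) ?_ ?_
  · have h1 : (1 : ℝ) ≤ 4 ^ r * (m : ℝ) ^ r := by
      rw [← mul_pow]; exact one_le_pow₀ (by linarith)
    nlinarith
  · intro e he
    have hec := G.card_edge e he
    have htot := sum_shearerWeight G.missing m (isIndep_missing_edge he)
    have hsmall := hsp.sum_shearerWeight_small_le hext e hqm
    rw [hec, ← hp] at htot hsmall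
    have hsplit := sum_filter_add_sum_filter_not (univ.filter fun Q : Finset V => e ⊆ Q)
      (fun Q => 2 * q ≤ #Q) (shearerWeight G.missing m)
    simp only [filter_filter, not_le] at hsplit
    have h0 : 0 ≤ ∑ Q with e ⊆ Q ∧ #Q < 2 * q, shearerWeight G.missing m Q :=
      sum_nonneg fun Q _ => hsp.shearerWeight_nonneg Q
    rw [← sum_div, div_sub_one hp0.ne', abs_div, abs_of_pos hp0, div_le_iff₀ hp0, abs_le]
    constructor <;> nlinarith

end RGraph

theorem mainTheorem1 (r : ℕ) (hr : 3 ≤ r) (ε : ℝ) (hε0 : 0 < ε) (hε1 : ε ≤ 1) :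
    ∃ C : ℝ, 0 < C ∧ ∀ q : ℕ, r < q →
      fractionalDecompositionThreshold q r ≤ 1 - C / (q : ℝ) ^ ((r : ℝ) - 1 + ε) ∧
      ∀ (V : Type) [Fintype V] [DecidableEq V] (G : RGraph V r),
        (1 - C / (q : ℝ) ^ ((r : ℝ) - 1 + ε)) * (Fintype.card V : ℝ) ≤ (G.minCodegree : ℝ) →
          G.HasFractionalDecomposition q := by
  obtain ⟨M, hM2, hM⟩ := exists_slots_factor r
  have hM0 : 0 < (M : ℝ) := by exact_mod_cast (by omega : 0 < M)
  have hC : 0 < (8 * (2 * (M : ℝ)) ^ (r - 1))⁻¹ := by positivity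
  refine ⟨(8 * (2 * (M : ℝ)) ^ (r - 1))⁻¹, hC, fun q hq => ?_⟩
  set C := (8 * (2 * (M : ℝ)) ^ (r - 1))⁻¹ with hCdef
  have hq1 : (1 : ℝ) ≤ q := by exact_mod_cast (by omega : 1 ≤ q)
  have hq0 : (0 : ℝ) < q := by linarith
  set c := C / (q : ℝ) ^ ((r : ℝ) - 1 + ε) with hc
  have hc0 : 0 < c := by positivity
  -- `q ^ (r - 1) ≤ q ^ (r - 1 + ε)`, and the constant `C` is chosen for the former
  have hcq : c * (8 * (2 * ((M * q : ℕ) : ℝ)) ^ (r - 1)) ≤ 1 := by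
    have h1 : (q : ℝ) ^ (r - 1) ≤ (q : ℝ) ^ ((r : ℝ) - 1 + ε) := by
      rw [← Real.rpow_natCast]
      refine Real.rpow_le_rpow_of_exponent_le hq1 ?_
      rw [Nat.cast_sub (by omega), Nat.cast_one]; linarith
    have h2 : 8 * (2 * ((M * q : ℕ) : ℝ)) ^ (r - 1) = C⁻¹ * (q : ℝ) ^ (r - 1) := by
      rw [hCdef, inv_inv]; push_cast; rw [← mul_assoc 2, mul_pow]; ring
    rw [h2, hc, div_mul_eq_mul_div, ← mul_assoc, mul_inv_cancel₀ hC.ne', one_mul]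
    exact div_le_one_of_le₀ h1 (by positivity)
  have key : ∀ (V : Type) [Fintype V] [DecidableEq V] (G : RGraph V r),
      (1 - c) * (Fintype.card V : ℝ) ≤ (G.minCodegree : ℝ) →
        G.HasFractionalDecomposition q := by
    intro V _ _ G hG
    rcases G.edges.eq_empty_or_nonempty with h | ⟨e, he⟩
    · exact ⟨fun _ => 0, fun _ _ => le_rfl, by simp [h]⟩
    have hS : ∀ S : Finset V, #S + 1 = r →
        (#(G.nonExtensions S) : ℝ) + (r - 1) ≤ c * Fintype.card V := by
      intro S hS
      have h1 : (#(G.nonExtensions S) : ℝ) + G.minCodegree + #S ≤ Fintype.card V := by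
        exact_mod_cast RGraph.card_nonExtensions_add hS
      have h2 : (#S : ℝ) + 1 = r := by exact_mod_cast hS
      linarith
    have hr3 : (3 : ℝ) ≤ r := by exact_mod_cast hr
    -- an edge forces `V` to be large, because the `r - 1` vertices of `S` are never extensions
    have hcn : 1 ≤ c * Fintype.card V := by
      obtain ⟨S, -, hSc⟩ := exists_subset_card_eq (s := e) (n := r - 1)
        (by rw [G.card_edge e he]; omega)
      have := hS S (by omega)
      linarith [Nat.cast_nonneg (α := ℝ) #(G.nonExtensions S)]
    have hdm : 8 * (c * Fintype.card V * (2 * ((M * q : ℕ) : ℝ)) ^ (r - 1)) ≤ Fintype.card V := by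
      have := mul_le_mul_of_nonneg_right hcq (Nat.cast_nonneg (α := ℝ) (Fintype.card V))
      linarith
    have hm1 : (1 : ℝ) ≤ 2 * ((M * q : ℕ) : ℝ) := by
      have : (1 : ℝ) ≤ ((M * q : ℕ) : ℝ) := by
        exact_mod_cast Nat.mul_pos (by omega : 0 < M) (by omega : 0 < q)
      linarith
    refine G.hasFractionalDecomposition_of_nonExtensions_le (by omega) hq.le
      (Nat.mul_le_mul_right q hM2) (d := c * Fintype.card V) (by positivity)
      (fun S h => by linarith [hS S h]) ?_ hdm (hM q (by omega))
    have h1 : 2 * ((M * q : ℕ) : ℝ) ≤ (2 * ((M * q : ℕ) : ℝ)) ^ (r - 1) :=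
      le_self_pow₀ hm1 (by omega)
    have h2 : 1 * (2 * ((M * q : ℕ) : ℝ)) ≤
        c * Fintype.card V * (2 * ((M * q : ℕ) : ℝ)) ^ (r - 1) := by
      gcongr
    linarith [Nat.cast_nonneg (α := ℝ) (M * q)]
  exact ⟨csInf_le (fractionalDecompositionConstants_bddBelow hq) key, key⟩

end Threshold
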